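/- **Monomials and moments.** Let $N\ge 1$, let $A_1,\dots,A_p$ be complex $N\times N$ matrices and let $\mathcal A=\mathbb C\langle u,u^{-1},a_i,a_i^*;1\le i\le p\rangle$ be the algebra of noncommutative polynomials in these (formally unrelated) letters. Let $P_1,\dots,P_l$ ($l\ge 1$) be monomials $$P_i=M_{i,1}u^{\epsilon_{i,1}}M_{i,2}u^{\epsilon_{i,2}}\cdots M_{i,d_i}u^{\epsilon_{i,d_i}},\qquad d_i\ge 1,\ \epsilon_{i,j}\in\{\pm1\},$$ where each $M_{i,j}$ is a (possibly empty) word in the letters $a_1,a_1^*,\dots,a_p,a_p^*$. Let $$\alpha^N_{0,l}(P_1,\dots,P_l)=\int_{\mathbb U(N)}\prod_{i=1}^l\operatorname{Tr}\big(P_i(U,U^*,A_1,A_1^*,\dots,A_p,A_p^*)\big)\,dU,$$ where $dU$ is the Haar probability measure. Put $\deg \mathbf P=d_1+\cdots+d_l$ and $m=\frac12\deg \mathbf P$. Number the factors consecutively, so that the pair $(i,j)$ gets the number $d_1+\cdots+d_{i-1}+j\in[2m]=\{1,\dots,\deg\mathbf P\}$, and let $\mathbf M_{\mathbf P}=(M_k)_{k\in[2m]}$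 (words evaluated at the $A_i,A_i^*$) and $\epsilon_{\mathbf P}=(\epsilon(k))_{k\in[2m]}$ be the families of words and signs. Let $\gamma_{\mathbf P}$ be the permutation of $[2m]$ having one cycle $(d_1+\cdots+d_{i-1}+1,\dots,d_1+\cdots+d_i)$ for each $i$. For a permutation $\sigma$ of $[2m]$ put $\operatorname{Tr}_\sigma(\mathbf M)=\prod_{c}\operatorname{Tr}(M_{i_1}M_{i_2}\cdots M_{i_k})$, the product being over all cycles $c=(i_1,\dots,i_k)$ of $\sigma$, fixed points included. **Maps.** An oriented map (not necessarily connected) is a graph with oriented edges embedded in a compact oriented surface with simply connected faces, up to orientation-preserving homeomorphism, given as a rotation system: a finite set of half-edges, a permutation $\sigma$ sending each half-edge to the next one counterclockwise around its vertex (the vertices are the cycles of $\sigma$), a fixed-point-free involution $\alpha$ exchanging the two half-edges of each edge, one of which is outgoing and the other ingoing; isomorphic systems are identified. The permutation $\varphi=\sigma^{-1}\alpha$ sends a half-edge to the next half-edge, counterclockwise around the face at its left, that has this face at its left. A map of unitary type with a finite totally ordered label set $I$ and $r$ black vertices is an oriented map with vertices colored black or white such that: 1. there are $r$ black vertices, numbered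 from $1$ to $r$; each has degree $4$, and ingoing and outgoing half-edges alternate around it; 2. the half-edges connected to white vertices (the white half-edges) are labelled bijectively by $I$; 3. if an edge is oriented from the black vertex number $k$ to the black vertex number $l$, then $k<l$. Isomorphisms preserve orientation, colors, numbers and labels. For such a map $\mathcal C$: * $\epsilon_{\mathcal C}(i)=+1$ if the white half-edge labelled $i$ is outgoing, and $-1$ if it is ingoing; * $\rho_{\mathcal C}(i)$ is the label of the half-edge following the white half-edge labelled $i$ counterclockwise around its vertex; * $\phi_{\mathcal C}(i)$ is the label of the first white half-edge among $\varphi(h),\varphi^2(h),\dots$, where $h$ is the white half-edge labelled $i$. A half-edge $h$ connected to a black vertex gets the label of the first white half-edge among $\varphi^{-1}(h),\varphi^{-2}(h),\dots$ (there always is one). The value of a black vertex is the largest of the labels of its outgoing half-edges, and $\mathcal C$ is nondecreasing if the values of the black vertices $1,\dots,r$ form a nondecreasing sequence. Let $\mathfrak C^r_{I,\epsilon,\rho}$ be the set of nondecreasing maps of unitary type with label set $I$, $r$ black vertices, $\epsilon_{\mathcal C}=\epsilon$ and $\rho_{\mathcal C}=\rho$. **Statement.** If $m\le N$, then the sets $\mathfrak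 C^r_{[2m],\epsilon_{\mathbf P},\gamma_{\mathbf P}^{-1}}$, $r\ge0$, are finite and $$\alpha^N_{0,l}(P_1,\dots,P_l)=\sum_{r\ge0}\frac{(-1)^r}{N^{r+m}}\sum_{\mathcal C\in\mathfrak C^r_{[2m],\epsilon_{\mathbf P},\gamma_{\mathbf P}^{-1}}}\operatorname{Tr}_{\phi_{\mathcal C}}(\mathbf M_{\mathbf P}),$$ and the series over $r$ converges absolutely. -/

import Mathlib

noncomputable section

namespace UnitaryMaps

open MeasureTheory

/-! ## Monomials in `u`, `u⁻¹`, `a_i`, `a_i^*` and their Haar moments -/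

/-- The letters `a_i`, `a_i^*`, for `i` in a set of `p` indices. -/
inductive CoeffLetter (p : ℕ) : Type
  | a (i : Fin p) : CoeffLetter p
  | aStar (i : Fin p) : CoeffLetter p

/-- The letters `u`, `u⁻¹` and `a_i`, `a_i^*`. -/
inductive Letter (p : ℕ) : Type
  | u : Letter p
  | uInv : Letter p
  | coeff (x : CoeffLetter p) : Letter p

/-- The algebra of noncommutative polynomials `ℂ⟨u, u⁻¹, a_i, a_i^*⟩`; there is no relation between
the formal variables. -/
abbrev NCPoly (p : ℕ) : Type := FreeAlgebra ℂ (Letter p)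

/-- A monomial `M₁ u^{ε₁} M₂ u^{ε₂} ⋯ M_d u^{ε_d}` with `d ≥ 1`, signs `ε_j = ±1` and (possibly
empty) words `M_j` in the letters `a_i`, `a_i^*`. -/
structure Monomial (p : ℕ) : Type where
  /-- the degree `d`, the total number of letters `u` and `u⁻¹` -/
  deg : ℕ
  deg_pos : 1 ≤ deg
  /-- the words `M_j` -/
  word : Fin deg → List (CoeffLetter p)
  /-- the signs `ε_j` -/
  sign : Fin deg → ℤˣ

/-- The monomial as an element of the algebra of noncommutative polynomials. -/
def Monomial.toPoly {p : ℕ} (P : Monomial p) : NCPoly p :=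
  (List.ofFn fun j : Fin P.deg =>
    ((P.word j).map fun x => FreeAlgebra.ι ℂ (Letter.coeff x)).prod *
      FreeAlgebra.ι ℂ (if P.sign j = 1 then Letter.u else Letter.uInv)).prod

section Moments

variable {N p : ℕ}

/-- The matrix substituted for a letter `a_i` or `a_i^*`. -/
def CoeffLetter.toMatrix (A : Fin p → Matrix (Fin N) (Fin N) ℂ) :
    CoeffLetter p → Matrix (Fin N) (Fin N) ℂ
  | CoeffLetter.a i => A i
  | CoeffLetter.aStar i => (A i).conjTranspose

/-- The matrix substituted for a letter; `u ↦ U` and `u⁻¹ ↦ U^*`. -/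
def Letter.toMatrix (A : Fin p → Matrix (Fin N) (Fin N) ℂ) (U : Matrix (Fin N) (Fin N) ℂ) :
    Letter p → Matrix (Fin N) (Fin N) ℂ
  | Letter.u => U
  | Letter.uInv => U.conjTranspose
  | Letter.coeff x => x.toMatrix A

/-- Evaluation of noncommutative polynomials at `U, U^*, A_1, A_1^*, …, A_p, A_p^*`. -/
def evalPoly (A : Fin p → Matrix (Fin N) (Fin N) ℂ) (U : Matrix (Fin N) (Fin N) ℂ) :
    NCPoly p →ₐ[ℂ] Matrix (Fin N) (Fin N) ℂ :=
  FreeAlgebra.lift ℂ (Letter.toMatrix A U)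

instance unitaryGroupMeasurableSpace (N : ℕ) :
    MeasurableSpace (Matrix.unitaryGroup (Fin N) ℂ) := borel _

instance unitaryGroupBorelSpace (N : ℕ) : BorelSpace (Matrix.unitaryGroup (Fin N) ℂ) := ⟨rfl⟩

instance unitaryGroupCompactSpace (N : ℕ) : CompactSpace (Matrix.unitaryGroup (Fin N) ℂ) := by
  refine isCompact_iff_compactSpace.mp ?_
  have hK : IsCompact (Set.univ.pi fun _ : Fin N => Set.univ.pi fun _ : Fin N =>
      Metric.closedBall (0 : ℂ) 1) :=
    isCompact_univ_pi fun _ => isCompact_univ_pi fun _ => isCompact_closedBall 0 1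
  refine IsCompact.of_isClosed_subset (X := Matrix (Fin N) (Fin N) ℂ) hK ?_ ?_
  · have hset : ((Matrix.unitaryGroup (Fin N) ℂ : Submonoid (Matrix (Fin N) (Fin N) ℂ)) :
        Set (Matrix (Fin N) (Fin N) ℂ)) = {U | star U * U = 1} := by
      ext U
      exact Matrix.mem_unitaryGroup_iff'
    rw [hset]
    exact isClosed_eq (by fun_prop) continuous_const
  · intro U hU i _ j _
    simpa using entry_norm_bound_of_unitary hU i j

/-- The Haar measure on the unitary group `𝕌(N)`, with total mass one. -/
def haarUnitary (N : ℕ) : Measure (Matrix.unitaryGroup (Fin N) ℂ) :=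
  Measure.haarMeasure ⊤

/-- The joint moment `α^N_{0,l}(Q₁, …, Q_l) = ∫ Tr(Q₁) ⋯ Tr(Q_l) dU` under the Haar measure. -/
def haarMoment (A : Fin p → Matrix (Fin N) (Fin N) ℂ) {l : ℕ} (Q : Fin l → NCPoly p) : ℂ :=
  ∫ U : Matrix.unitaryGroup (Fin N) ℂ,
    ∏ i, (evalPoly A (U : Matrix (Fin N) (Fin N) ℂ) (Q i)).trace ∂(haarUnitary N)

end Moments

/-! ## The data attached to a tuple of monomials

The factors of `P₁, …, P_l` are numbered consecutively (starting at `0`): the `j`-th factor of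
`P_i` has the number `d₁ + ⋯ + d_{i-1} + j`. This is the bijection `finSigmaFinEquiv`. -/

section Tuples

variable {p l : ℕ}

/-- The total degree `d₁ + ⋯ + d_l`. -/
abbrev totalDeg (P : Fin l → Monomial p) : ℕ := ∑ i, (P i).deg

/-- The signs `(ε_{1,1}, …, ε_{1,d₁}, …, ε_{l,1}, …, ε_{l,d_l})`. -/
def signs (P : Fin l → Monomial p) (k : Fin (totalDeg P)) : ℤˣ :=
  (P (finSigmaFinEquiv.symm k).1).sign (finSigmaFinEquiv.symm k).2

/-- The matrices `(M_{1,1}, …, M_{1,d₁}, …, M_{l,1}, …, M_{l,d_l})`. -/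
def coeffs {N : ℕ} (A : Fin p → Matrix (Fin N) (Fin N) ℂ) (P : Fin l → Monomial p)
    (k : Fin (totalDeg P)) : Matrix (Fin N) (Fin N) ℂ :=
  (((P (finSigmaFinEquiv.symm k).1).word (finSigmaFinEquiv.symm k).2).map
    (CoeffLetter.toMatrix A)).prod

/-- The permutation `(1, …, d₁)(d₁ + 1, …, d₁ + d₂) ⋯` with one cycle for each monomial. -/
def gammaPerm (P : Fin l → Monomial p) : Equiv.Perm (Fin (totalDeg P)) :=
  finSigmaFinEquiv.permCongr (Equiv.Perm.sigmaCongrRight fun i => finRotate (P i).deg)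

end Tuples

/-! ## Traces along a permutation -/

section Traces

variable {N : ℕ} {I : Type} [Fintype I]

/-- `Tr(M_{i} M_{σ(i)} M_{σ²(i)} ⋯)`, the product running once along the cycle of `i`. -/
def cycleTrace (σ : Equiv.Perm I) (M : I → Matrix (Fin N) (Fin N) ℂ) (i : I) : ℂ :=
  (List.ofFn fun k : Fin (Function.minimalPeriod σ i) => M ((σ ^ (k : ℕ)) i)).prod.trace

theorem cycleTrace_apply (σ : Equiv.Perm I) (M : I → Matrix (Fin N) (Fin N) ℂ) (i : I) :
    cycleTrace σ M (σ i) = cycleTrace σ M i := by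
  have hper : i ∈ Function.periodicPts σ :=
    (Function.Injective.mem_periodicPts σ.injective i)
  have hmp : Function.minimalPeriod σ (σ i) = Function.minimalPeriod σ i :=
    Function.minimalPeriod_apply hper
  have hlast : (σ ^ Function.minimalPeriod σ i) i = i := by
    rw [Equiv.Perm.coe_pow]
    exact Function.isPeriodicPt_minimalPeriod σ i
  have hpos := Function.minimalPeriod_pos_of_mem_periodicPts hper
  unfold cycleTrace
  rw [hmp]
  generalize Function.minimalPeriod σ i = d at hpos hlast
  obtain ⟨c, rfl⟩ : ∃ c, d = c + 1 := ⟨d - 1, by omega⟩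
  have h1 : (List.ofFn fun k : Fin (c + 1) => M ((σ ^ (k : ℕ)) (σ i))).prod =
      (List.ofFn fun k : Fin c => M ((σ ^ ((k : ℕ) + 1)) i)).prod * M i := by
    rw [List.ofFn_succ', List.concat_eq_append, List.prod_append]
    simp only [Fin.val_castSucc, Fin.val_last, List.prod_singleton, pow_succ,
      Equiv.Perm.mul_apply] at hlast ⊢
    rw [hlast]
  have h2 : (List.ofFn fun k : Fin (c + 1) => M ((σ ^ (k : ℕ)) i)).prod =
      M i * (List.ofFn fun k : Fin c => M ((σ ^ ((k : ℕ) + 1)) i)).prod := by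
    rw [List.ofFn_succ, List.prod_cons]
    simp
  rw [h1, h2, Matrix.trace_mul_comm]

theorem cycleTrace_congr (σ : Equiv.Perm I) (M : I → Matrix (Fin N) (Fin N) ℂ) (i j : I)
    (h : σ.SameCycle i j) : cycleTrace σ M i = cycleTrace σ M j := by
  obtain ⟨n, -, rfl⟩ := h.exists_pow_eq'
  induction n with
  | zero => simp
  | succ n ih =>
    rw [pow_succ', Equiv.Perm.mul_apply, cycleTrace_apply]
    exact ih ⟨n, by simp⟩

open Classical in
/-- `Tr_σ(M)`, the product over all the cycles of `σ` (fixed points included) of the trace of the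
product of the matrices along the cycle. -/
def permTrace (σ : Equiv.Perm I) (M : I → Matrix (Fin N) (Fin N) ℂ) : ℂ :=
  ∏ c : Quotient (Equiv.Perm.SameCycle.setoid σ),
    Quotient.lift (cycleTrace σ M) (fun i j h => cycleTrace_congr σ M i j h) c

end Traces

/-! ## First return permutations -/

section FirstReturn

variable {H : Type} [Finite H]

theorem exists_return (f : Equiv.Perm H) (p : H → Prop) (x : {h // p h}) :
    ∃ k : ℕ, 0 < k ∧ p ((f ^ k) x) :=
  ⟨orderOf f, orderOf_pos f, by rw [pow_orderOf_eq_one]; exact x.2⟩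

open Classical in
/-- The first element satisfying `p` among `f x, f² x, f³ x, …`. -/
def firstReturnFun (f : Equiv.Perm H) (p : H → Prop) (x : {h // p h}) : {h // p h} :=
  ⟨(f ^ Nat.find (exists_return f p x)) x, (Nat.find_spec (exists_return f p x)).2⟩

theorem firstReturnFun_eq (f : Equiv.Perm H) (p : H → Prop) (x y : {h // p h}) {k : ℕ}
    (hk : 0 < k) (hy : (f ^ k) (x : H) = y) (hmin : ∀ j, 0 < j → j < k → ¬ p ((f ^ j) x)) :
    firstReturnFun f p x = y := by
  classical
  have : Nat.find (exists_return f p x) = k := by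
    rw [Nat.find_eq_iff]
    exact ⟨⟨hk, by rw [hy]; exact y.2⟩, fun j hj hc => hmin j hc.1 hj hc.2⟩
  apply Subtype.ext
  simp only [firstReturnFun]
  rw [← hy]
  congr 2

theorem firstReturnFun_spec (f : Equiv.Perm H) (p : H → Prop) (x : {h // p h}) :
    ∃ k : ℕ, 0 < k ∧ (f ^ k) (x : H) = firstReturnFun f p x ∧
      ∀ j, 0 < j → j < k → ¬ p ((f ^ j) x) := by
  classical
  refine ⟨Nat.find (exists_return f p x), (Nat.find_spec (exists_return f p x)).1, ?_, ?_⟩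
  · simp only [firstReturnFun]
  · intro j hj hlt hp
    exact Nat.find_min (exists_return f p x) hlt ⟨hj, hp⟩

theorem firstReturnFun_injective (f : Equiv.Perm H) (p : H → Prop) :
    Function.Injective (firstReturnFun f p) := by
  have key : ∀ (x y : {h // p h}) (a b : ℕ), 0 < a → a ≤ b →
      (f ^ a) (x : H) = (f ^ b) (y : H) → (∀ j, 0 < j → j < b → ¬ p ((f ^ j) y)) → x = y := by
    intro x y a b ha hab hxy hmin
    obtain ⟨c, rfl⟩ := Nat.exists_eq_add_of_le hab
    rw [pow_add, Equiv.Perm.mul_apply] at hxy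
    have hx : (x : H) = (f ^ c) y := (f ^ a).injective hxy
    rcases Nat.eq_zero_or_pos c with rfl | hc
    · exact Subtype.ext (by simpa using hx)
    · exact absurd (by rw [← hx]; exact x.2) (hmin c hc (by omega))
  intro x y hxy
  obtain ⟨a, ha, hax, hamin⟩ := firstReturnFun_spec f p x
  obtain ⟨b, hb, hby, hbmin⟩ := firstReturnFun_spec f p y
  rcases le_total a b with h | h
  · exact key x y a b ha h (by rw [hax, hby, hxy]) hbmin
  · exact (key y x b a hb h (by rw [hax, hby, hxy]) hamin).symm

/-- The first return permutation of `f` on the subset defined by `p`. -/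
def firstReturn (f : Equiv.Perm H) (p : H → Prop) : Equiv.Perm {h // p h} :=
  Equiv.ofBijective (firstReturnFun f p)
    (Finite.injective_iff_bijective.mp (firstReturnFun_injective f p))

end FirstReturn

/-! ## Oriented maps -/

/-- An oriented map (not necessarily connected), given as a rotation system: a finite set of
half-edges, the permutation `next` sending a half-edge to the next one in the counterclockwise
direction around its vertex, the fixed point free involution `opp` exchanging the two half-edges of
an edge, and the orientation: `sign h = 1` if `h` is outgoing, `sign h = -1` if `h` is ingoing. -/
structure OrientedMap : Type 1 where
  HalfEdge : Type
  finite : Finite HalfEdge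
  next : Equiv.Perm HalfEdge
  opp : Equiv.Perm HalfEdge
  opp_opp : ∀ h, opp (opp h) = h
  opp_ne : ∀ h, opp h ≠ h
  sign : HalfEdge → ℤˣ
  sign_opp : ∀ h, sign (opp h) = -sign h

namespace OrientedMap

variable (C : OrientedMap)

instance : Finite C.HalfEdge := C.finite

/-- The vertices are the cycles of `next`. -/
def Vertex : Type := Quotient (Equiv.Perm.SameCycle.setoid C.next)

/-- The vertex to which a half-edge is connected. -/
def vertex (h : C.HalfEdge) : C.Vertex :=
  Quotient.mk (Equiv.Perm.SameCycle.setoid C.next) h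

/-- Starting from the half-edge `h` and turning in the counterclockwise direction around the face
at the left of `h`, the next half-edge with this face at its left. (Walk along the edge of `h`
with the face at the left, then turn left, that is, take the next half-edge in the clockwise
direction around the vertex that was reached.) The faces are the cycles of this permutation. -/
def face : Equiv.Perm C.HalfEdge := C.opp.trans C.next.symm

theorem vertex_next (h : C.HalfEdge) : C.vertex (C.next h) = C.vertex h :=
  Quotient.sound (s := Equiv.Perm.SameCycle.setoid C.next)
    (Equiv.Perm.sameCycle_apply_left.mpr (Equiv.Perm.SameCycle.refl _ _))

theorem next_face (h : C.HalfEdge) : C.next (C.face h) = C.opp h := by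
  simp [face]

theorem vertex_face (h : C.HalfEdge) : C.vertex (C.face h) = C.vertex (C.opp h) := by
  rw [← C.next_face, C.vertex_next]

end OrientedMap

/-! ## Maps of unitary type -/

/-- A map of unitary type with labels in `I` and `r` black vertices. The numbers of the black
vertices are the elements of `Fin r`. -/
structure UnitaryMap (I : Type) (r : ℕ) : Type 1 extends OrientedMap where
  /-- the black vertices; the other vertices are white -/
  IsBlack : toOrientedMap.Vertex → Prop
  /-- the numbering of the black vertices -/
  black : Fin r ≃ {v // IsBlack v}
  degree_black : ∀ v, IsBlack v → Nat.card {h // toOrientedMap.vertex h = v} = 4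
  alternated_black : ∀ h, IsBlack (toOrientedMap.vertex h) → sign (next h) = -sign h
  /-- the labelling of the white half-edges, those connected to white vertices -/
  white : I ≃ {h // ¬ IsBlack (toOrientedMap.vertex h)}
  /-- an edge from the black vertex number `k` to the black vertex number `l` has `k < l` -/
  number_lt : ∀ (h : HalfEdge) (k l : Fin r), sign h = 1 →
    toOrientedMap.vertex h = black k → toOrientedMap.vertex (opp h) = black l → k < l

namespace UnitaryMap

variable {I : Type} {r : ℕ} (C : UnitaryMap I r)

/-- The half-edge `h` is white, i.e. connected to a white vertex. -/
def IsWhite (h : C.HalfEdge) : Prop := ¬ C.IsBlack (C.vertex h)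

theorem isWhite_next (h : C.HalfEdge) : C.IsWhite (C.next h) ↔ C.IsWhite h := by
  rw [IsWhite, IsWhite, C.vertex_next]

/-- `ε_C`: the orientation of the white half-edges. -/
def eps (i : I) : ℤˣ := C.sign (C.white i)

/-- `ρ_C`: the next half-edge counterclockwise around a white vertex, in terms of labels. -/
def rho : Equiv.Perm I :=
  (C.white.trans (C.next.subtypePerm C.isWhite_next)).trans C.white.symm

/-- `φ_C`: the next white half-edge around the face at the left of a white half-edge, turning
counterclockwise around the face, in terms of labels. -/
def phi : Equiv.Perm I :=
  (C.white.trans (firstReturn C.face C.IsWhite)).trans C.white.symm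

/-- Each face is incident to a white vertex. -/
theorem exists_white_face (h : C.HalfEdge) : ∃ k : ℕ, C.IsWhite ((C.face ^ k) h) := by
  by_contra hcon
  have hb : ∀ k : ℕ, C.IsBlack (C.vertex ((C.face ^ k) h)) := fun k => by
    by_contra hk
    exact hcon ⟨k, hk⟩
  have hsucc : ∀ k : ℕ, (C.face ^ (k + 1)) h = C.face ((C.face ^ k) h) := fun k => by
    rw [pow_succ', Equiv.Perm.mul_apply]
  have hsign : ∀ k : ℕ, C.sign ((C.face ^ k) h) = C.sign h := by
    intro k
    induction k with
    | zero => simp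
    | succ k ih =>
      have := C.alternated_black _ (hb (k + 1))
      rw [hsucc, C.next_face, C.sign_opp, neg_inj, ih] at this
      rw [hsucc, ← this]
  let n : ℕ → Fin r := fun k => C.black.symm ⟨_, hb k⟩
  have hn : ∀ k, C.vertex ((C.face ^ k) h) = C.black (n k) := fun k => by simp [n]
  have hopp : ∀ k, C.vertex (C.opp ((C.face ^ k) h)) = C.black (n (k + 1)) := fun k => by
    rw [← C.vertex_face, ← hsucc, hn]
  have hper : n (orderOf C.face) = n 0 := by
    apply C.black.injective
    apply Subtype.ext
    rw [← hn, ← hn, pow_orderOf_eq_one, pow_zero]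
  have hpos := orderOf_pos C.face
  rcases Int.units_eq_one_or (C.sign h) with hs | hs
  · have hmono : StrictMono n := strictMono_nat_of_lt_succ fun k =>
      C.number_lt _ _ _ ((hsign k).trans hs) (hn k) (hopp k)
    exact (hmono hpos).ne' hper
  · have hanti : StrictAnti n := strictAnti_nat_of_succ_lt fun k =>
      C.number_lt (C.opp ((C.face ^ k) h)) _ _ (by rw [C.sign_opp, hsign, hs, neg_neg])
        (hopp k) (by rw [C.opp_opp]; exact hn k)
    exact (hanti hpos).ne hper

theorem exists_white_face_inv (h : C.HalfEdge) : ∃ k : ℕ, C.IsWhite ((C.face⁻¹ ^ k) h) := by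
  obtain ⟨k, hk⟩ := C.exists_white_face h
  have : (C.face⁻¹).SameCycle h ((C.face ^ k) h) :=
    Equiv.Perm.sameCycle_inv.mpr ⟨k, by simp⟩
  obtain ⟨j, -, hj⟩ := this.exists_pow_eq'
  exact ⟨j, by rw [hj]; exact hk⟩

open Classical in
/-- The label of an arbitrary half-edge `h`: that of the first white half-edge encountered (`h`
included) when turning in the clockwise direction around the face at the left of `h`. -/
def labelOf (h : C.HalfEdge) : I :=
  C.white.symm ⟨(C.face⁻¹ ^ Nat.find (C.exists_white_face_inv h)) h,
    Nat.find_spec (C.exists_white_face_inv h)⟩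

theorem exists_outgoing (k : Fin r) : ∃ h, C.vertex h = C.black k ∧ C.sign h = 1 := by
  obtain ⟨h, hh⟩ := Quotient.exists_rep (C.black k).1
  change C.vertex h = _ at hh
  rcases Int.units_eq_one_or (C.sign h) with hs | hs
  · exact ⟨h, hh, hs⟩
  · refine ⟨C.next h, by rw [C.vertex_next, hh], ?_⟩
    rw [C.alternated_black h (by rw [hh]; exact (C.black k).2), hs, neg_neg]

/-- The value of the black vertex number `k`: the largest of the labels of the outgoing half-edges
connected to it. -/
def val [LinearOrder I] (k : Fin r) : I :=
  ((Set.toFinite {h | C.vertex h = C.black k ∧ C.sign h = 1}).toFinset.image C.labelOf).max' (by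
    obtain ⟨h, hh⟩ := C.exists_outgoing k
    exact ⟨C.labelOf h, Finset.mem_image_of_mem _ (by simpa using hh)⟩)

/-- The map is nondecreasing: `val(b₁) ≤ val(b₂) ≤ ⋯ ≤ val(b_r)`. -/
def IsNondecreasing [LinearOrder I] : Prop := Monotone C.val

/-- An isomorphism of maps of unitary type: a bijection between the half-edges which preserves the
cyclic order around the vertices, the edges, the orientation, the colours, the numbering of the
black vertices and the labels of the white half-edges. -/
structure Iso (C D : UnitaryMap I r) : Type where
  toEquiv : C.HalfEdge ≃ D.HalfEdge
  map_next : ∀ h, toEquiv (C.next h) = D.next (toEquiv h)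
  map_opp : ∀ h, toEquiv (C.opp h) = D.opp (toEquiv h)
  map_sign : ∀ h, D.sign (toEquiv h) = C.sign h
  map_isWhite : ∀ h, D.IsWhite (toEquiv h) ↔ C.IsWhite h
  map_black : ∀ h k, D.vertex (toEquiv h) = D.black k ↔ C.vertex h = C.black k
  map_white : ∀ i, toEquiv (C.white i) = D.white i

/-- The identity isomorphism. -/
def Iso.refl (C : UnitaryMap I r) : Iso C C where
  toEquiv := Equiv.refl _
  map_next _ := rfl
  map_opp _ := rfl
  map_sign _ := rfl
  map_isWhite _ := Iff.rfl
  map_black _ _ := Iff.rfl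
  map_white _ := rfl

/-- The inverse isomorphism. -/
def Iso.symm {C D : UnitaryMap I r} (e : Iso C D) : Iso D C where
  toEquiv := e.toEquiv.symm
  map_next h := by rw [Equiv.symm_apply_eq, e.map_next, Equiv.apply_symm_apply]
  map_opp h := by rw [Equiv.symm_apply_eq, e.map_opp, Equiv.apply_symm_apply]
  map_sign h := by rw [← e.map_sign, Equiv.apply_symm_apply]
  map_isWhite h := by rw [← e.map_isWhite, Equiv.apply_symm_apply]
  map_black h k := by rw [← e.map_black, Equiv.apply_symm_apply]
  map_white i := by rw [Equiv.symm_apply_eq, e.map_white]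

/-- The composition of two isomorphisms. -/
def Iso.trans {C D E : UnitaryMap I r} (e : Iso C D) (f : Iso D E) : Iso C E where
  toEquiv := e.toEquiv.trans f.toEquiv
  map_next h := by simp [e.map_next, f.map_next]
  map_opp h := by simp [e.map_opp, f.map_opp]
  map_sign h := by simp [e.map_sign, f.map_sign]
  map_isWhite h := by simp [e.map_isWhite, f.map_isWhite]
  map_black h k := by simp [e.map_black, f.map_black]
  map_white i := by simp [e.map_white, f.map_white]

theorem Iso.map_face {C D : UnitaryMap I r} (e : Iso C D) (h : C.HalfEdge) :
    e.toEquiv (C.face h) = D.face (e.toEquiv h) := by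
  apply D.next.injective
  rw [D.next_face, ← e.map_next, C.next_face, e.map_opp]

theorem Iso.map_face_pow {C D : UnitaryMap I r} (e : Iso C D) (k : ℕ) (h : C.HalfEdge) :
    e.toEquiv ((C.face ^ k) h) = (D.face ^ k) (e.toEquiv h) := by
  induction k with
  | zero => simp
  | succ k ih => rw [pow_succ', pow_succ', Equiv.Perm.mul_apply, Equiv.Perm.mul_apply,
      e.map_face, ih]

theorem Iso.phi_eq {C D : UnitaryMap I r} (e : Iso C D) : C.phi = D.phi := by
  ext i
  obtain ⟨k, hk, hki, hmin⟩ := firstReturnFun_spec C.face C.IsWhite (C.white i)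
  have hD : firstReturnFun D.face D.IsWhite (D.white i) = D.white (C.phi i) := by
    refine firstReturnFun_eq D.face D.IsWhite _ _ hk ?_ ?_
    · rw [← e.map_white, ← e.map_face_pow, hki, ← e.map_white]
      congr 2
      exact (C.white.apply_symm_apply _).symm
    · intro j hj hlt
      rw [← e.map_white, ← e.map_face_pow, e.map_isWhite]
      exact hmin j hj hlt
  have : D.phi i = D.white.symm (firstReturnFun D.face D.IsWhite (D.white i)) := rfl
  rw [this, hD]
  exact (D.white.symm_apply_apply _).symm

end UnitaryMap

/-- The nondecreasing maps of unitary type `C` with labels in `I`, with `r` black vertices, and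
with `ε_C = ε` and `ρ_C = ρ`, before isomorphic ones are identified. -/
def NondecreasingMap (I : Type) [LinearOrder I] (r : ℕ) (ε : I → ℤˣ) (ρ : Equiv.Perm I) :
    Type 1 :=
  {C : UnitaryMap I r // C.IsNondecreasing ∧ C.eps = ε ∧ C.rho = ρ}

/-- Isomorphism of maps of unitary type. -/
instance NondecreasingMap.setoid (I : Type) [LinearOrder I] (r : ℕ) (ε : I → ℤˣ)
    (ρ : Equiv.Perm I) : Setoid (NondecreasingMap I r ε ρ) where
  r C D := Nonempty (UnitaryMap.Iso C.1 D.1)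
  iseqv :=
    { refl := fun C => ⟨UnitaryMap.Iso.refl C.1⟩
      symm := fun ⟨e⟩ => ⟨e.symm⟩
      trans := fun ⟨e⟩ ⟨f⟩ => ⟨e.trans f⟩ }

/-- The set `ℭ^r_{I, ε, ρ}` of nondecreasing maps of unitary type with labels in `I`, with `r` black
vertices, and with `ε_C = ε` and `ρ_C = ρ`, up to isomorphism. -/
def MapClass (I : Type) [LinearOrder I] (r : ℕ) (ε : I → ℤˣ) (ρ : Equiv.Perm I) : Type 1 :=
  Quotient (NondecreasingMap.setoid I r ε ρ)

/-- The permutation `φ_C` of a map considered up to isomorphism. -/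
def MapClass.phi {I : Type} [LinearOrder I] {r : ℕ} {ε : I → ℤˣ} {ρ : Equiv.Perm I}
    (C : MapClass I r ε ρ) : Equiv.Perm I :=
  Quotient.lift (s := NondecreasingMap.setoid I r ε ρ) (fun D => D.1.phi)
    (fun _ _ h => Nonempty.elim h fun e => e.phi_eq) C

/-- The set `ℭ^r_{[2m], ε_P, γ_P⁻¹}`, where `2m = deg P`. -/
abbrev MapsOf {p l : ℕ} (P : Fin l → Monomial p) (r : ℕ) : Type 1 :=
  MapClass (Fin (totalDeg P)) r (signs P) (gammaPerm P)⁻¹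

/-- The sum of `Tr_{φ_C}(M_P)` over the maps `C` in `ℭ^r_{[2m], ε_P, γ_P⁻¹}`. -/
def mapSum {N p l : ℕ} (A : Fin p → Matrix (Fin N) (Fin N) ℂ) (P : Fin l → Monomial p)
    (r : ℕ) : ℂ :=
  ∑ᶠ C : MapsOf P r, permTrace C.phi (coeffs A P)

end UnitaryMaps

end

/-!
Expanding the traces over indices reduces the claim to the moments `E(i, j, i', j')` of products of
entries of `U` and `U*`. Invariance of the Haar measure under one-parameter groups
(the Schwinger–Dyson equations) gives `N E + ∑ₐ E ∘ (a last) = (moments with one factor fewer)`, a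
sum of `n - 1 < N` transpositions; since transpositions act isometrically, `N + ∑ₐ (a last)` is
inverted by its Neumann series. Iterating over the number of factors, the coefficient of
`(-1)^r / N^(r + n)` counts pairs formed by a product `(a₁ b₁) ⋯ (a_r b_r)` of transpositions with
`a_t < b_t` and `b₁ ≤ ⋯ ≤ b_r` and by a compatible matching of the factors `U` with the factors
`U*`.

Such pairs are nondecreasing maps. Start a strand at each outgoing white half-edge and turn left at
each black vertex it meets. Every black vertex lies on exactly two strands, which give a
transposition whose larger element is the value of the vertex, and the ends of the strands give the
matching. The strands from outgoing to ingoing half-edges and those in the opposite direction are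
the values of `φ_C` on the two kinds of labels.
-/

noncomputable section

namespace UnitaryMaps

open MeasureTheory

/-! ## Traces as sums over indices -/

section Traces

section Enumeration

variable {I κ n R : Type*} [Fintype I] [DecidableEq I] [Fintype κ] [Fintype n]
  [CommSemiring R]

theorem sum_prod_mul_apply (M B : I → Matrix n n R) (γ : I → I) :
    ∑ x : I → n, ∏ k, (M k * B k) (x k) (x (γ k)) =
      ∑ x : I → n, ∑ y : I → n, (∏ k, M k (x k) (y k)) * ∏ k, B k (y k) (x (γ k)) := by
  refine Finset.sum_congr rfl fun x _ => ?_
  simp_rw [Matrix.mul_apply]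
  rw [Finset.prod_univ_sum, Fintype.piFinset_univ]
  exact Finset.sum_congr rfl fun y _ => Finset.prod_mul_distrib

variable [DecidableEq n]

theorem list_ofFn_prod_apply {d : ℕ} (B : Fin (d + 1) → Matrix n n R) (a b : n) :
    (List.ofFn B).prod a b = ∑ v : Fin d → n,
      ∏ k, B k (Fin.cons (α := fun _ => n) a v k) (Fin.snoc (α := fun _ => n) v b k) := by
  induction d generalizing a with
  | zero => simp [List.ofFn_succ, Fin.snoc]
  | succ d ih =>
    rw [List.ofFn_succ, List.prod_cons, Matrix.mul_apply,
      ← (Fin.consEquiv fun _ : Fin (d + 1) => n).sum_comp, Fintype.sum_prod_type]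
    refine Finset.sum_congr rfl fun c _ => ?_
    rw [ih, Finset.mul_sum]
    refine Finset.sum_congr rfl fun v _ => ?_
    have hsnoc : (Fin.snoc (α := fun _ => n) (Fin.cons (α := fun _ => n) c v) b :
        Fin (d + 1 + 1) → n) = Fin.cons (α := fun _ => n) c (Fin.snoc (α := fun _ => n) v b) :=
      (Fin.cons_snoc_eq_snoc_cons (β := n) c v b).symm
    rw [show (Fin.consEquiv fun _ : Fin (d + 1) => n) (c, v) =
      (Fin.cons (α := fun _ => n) c v) from rfl, hsnoc, Fin.prod_univ_succ (n := d + 1)]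
    rfl

theorem trace_list_ofFn_prod {d : ℕ} (hd : 0 < d) (B : Fin d → Matrix n n R) :
    (List.ofFn B).prod.trace = ∑ x : Fin d → n, ∏ k, B k (x k) (x (finRotate d k)) := by
  obtain ⟨d, rfl⟩ := Nat.exists_eq_succ_of_ne_zero hd.ne'
  rw [← (Fin.consEquiv fun _ : Fin (d + 1) => n).sum_comp, Fintype.sum_prod_type, Matrix.trace]
  refine Finset.sum_congr rfl fun a _ => ?_
  rw [Matrix.diag_apply, list_ofFn_prod_apply]
  refine Finset.sum_congr rfl fun v _ => Finset.prod_congr rfl fun k _ => ?_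
  rw [Fin.snoc_eq_cons_rotate]
  rfl

theorem prod_trace_list_ofFn_prod {d : κ → ℕ} (hd : ∀ c, 0 < d c) (σ : Equiv.Perm I)
    (e : (Σ c, Fin (d c)) ≃ I)
    (he : ∀ q, e (Equiv.Perm.sigmaCongrRight (fun c => finRotate (d c)) q) = σ (e q))
    (M : I → Matrix n n R) :
    ∏ c, (List.ofFn fun k => M (e ⟨c, k⟩)).prod.trace =
      ∑ x : I → n, ∏ k, M k (x k) (x (σ k)) := by
  classical
  simp_rw [trace_list_ofFn_prod (hd _)]
  rw [Finset.prod_univ_sum, Fintype.piFinset_univ,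
    ← (Equiv.piCurry fun (c : κ) (_ : Fin (d c)) => n).sum_comp,
    ← (e.arrowCongr (Equiv.refl n)).symm.sum_comp]
  refine Finset.sum_congr rfl fun x _ => ?_
  rw [← e.prod_comp, Fintype.prod_sigma]
  simp_rw [← he]
  rfl

end Enumeration

section Cycles

variable {I : Type*} [Finite I] (σ : Equiv.Perm I)

theorem minimalPeriod_perm_pos (i : I) : 0 < Function.minimalPeriod σ i :=
  Function.minimalPeriod_pos_of_mem_periodicPts (σ.injective.mem_periodicPts i)

theorem bijective_pow_out : Function.Bijective
    fun q : Σ c : Quotient (Equiv.Perm.SameCycle.setoid σ),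
      Fin (Function.minimalPeriod σ c.out) => (σ ^ (q.2 : ℕ)) q.1.out := by
  constructor
  · rintro ⟨c, k⟩ ⟨c', k'⟩ h
    have class_eq : ∀ (c : Quotient (Equiv.Perm.SameCycle.setoid σ)) (k : ℕ),
        Quotient.mk _ ((σ ^ k) c.out) = c := fun c k =>
      Quotient.mk_eq_iff_out.mpr (Equiv.Perm.SameCycle.symm ⟨k, by simp⟩)
    obtain rfl : c = c' := (class_eq c k).symm.trans ((congrArg _ h).trans (class_eq c' k'))
    simp only [Equiv.Perm.coe_pow] at h
    rw [Fin.ext (Function.iterate_injOn_Iio_minimalPeriod k.2 k'.2 h)]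
  · intro i
    obtain ⟨n, -, hn⟩ := Equiv.Perm.SameCycle.exists_pow_eq'
      (Quotient.mk_out (s := Equiv.Perm.SameCycle.setoid σ) i)
    refine ⟨⟨Quotient.mk _ i, ⟨n % _, Nat.mod_lt n (minimalPeriod_perm_pos σ _)⟩⟩, ?_⟩
    simp only [Equiv.Perm.coe_pow] at hn ⊢
    exact Function.iterate_mod_minimalPeriod_eq.trans hn

/-- The enumeration of the points of `σ` cycle by cycle, starting from a representative of each
cycle. -/
def cycleEnum : (Σ c : Quotient (Equiv.Perm.SameCycle.setoid σ),
    Fin (Function.minimalPeriod σ c.out)) ≃ I :=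
  Equiv.ofBijective _ (bijective_pow_out σ)

theorem cycleEnum_rotate (q : Σ c : Quotient (Equiv.Perm.SameCycle.setoid σ),
    Fin (Function.minimalPeriod σ c.out)) :
    cycleEnum σ (Equiv.Perm.sigmaCongrRight (fun _ => finRotate _) q) = σ (cycleEnum σ q) := by
  obtain ⟨c, k⟩ := q
  change (σ ^ (finRotate (Function.minimalPeriod σ c.out) k : ℕ)) c.out =
    σ ((σ ^ (k : ℕ)) c.out)
  rw [← Equiv.Perm.mul_apply, ← pow_succ']
  have hperiod := Function.isPeriodicPt_minimalPeriod σ c.out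
  generalize Function.minimalPeriod σ c.out = d at k hperiod
  obtain ⟨n, rfl⟩ : ∃ n, d = n + 1 := Nat.exists_eq_succ_of_ne_zero k.pos.ne'
  rw [coe_finRotate]
  split_ifs with hk
  · subst hk
    rw [pow_zero, Equiv.Perm.one_apply, Equiv.Perm.coe_pow]
    exact hperiod.symm
  · rfl

end Cycles

theorem permTrace_eq_sum {I : Type} [Fintype I] [DecidableEq I] {N : ℕ} (σ : Equiv.Perm I)
    (M : I → Matrix (Fin N) (Fin N) ℂ) :
    permTrace σ M = ∑ x : I → Fin N, ∏ k, M k (x k) (x (σ k)) := by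
  classical
  rw [← prod_trace_list_ofFn_prod (fun _ => minimalPeriod_perm_pos σ _) σ (cycleEnum σ)
    (cycleEnum_rotate σ) M]
  refine Finset.prod_congr rfl fun c _ => ?_
  conv_lhs => rw [← Quotient.out_eq c]
  rfl

section Monomials

variable {N p : ℕ} (A : Fin p → Matrix (Fin N) (Fin N) ℂ)

theorem coe_zpow_units (U : Matrix.unitaryGroup (Fin N) ℂ) (s : ℤˣ) :
    ((U ^ (s : ℤ) : Matrix.unitaryGroup (Fin N) ℂ) : Matrix (Fin N) (Fin N) ℂ) =
      if s = 1 then (U : Matrix (Fin N) (Fin N) ℂ)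
      else (U : Matrix (Fin N) (Fin N) ℂ).conjTranspose := by
  rcases Int.units_eq_one_or s with rfl | rfl
  · simp
  · simp [Matrix.star_eq_conjTranspose]

theorem evalPoly_toPoly (U : Matrix.unitaryGroup (Fin N) ℂ) (P : Monomial p) :
    evalPoly A U P.toPoly = (List.ofFn fun j =>
      ((P.word j).map (CoeffLetter.toMatrix A)).prod *
        ((U ^ (P.sign j : ℤ) : Matrix.unitaryGroup (Fin N) ℂ) :
          Matrix (Fin N) (Fin N) ℂ)).prod := by
  rw [Monomial.toPoly, map_list_prod, List.map_ofFn]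
  congr 2
  funext j
  rw [coe_zpow_units, Function.comp_apply, map_mul, map_list_prod, List.map_map]
  congr 2
  · refine List.map_congr_left fun x _ => ?_
    simp [evalPoly, Letter.toMatrix]
  · split_ifs <;> simp [evalPoly, Letter.toMatrix]

theorem coeffs_finSigmaFinEquiv {l : ℕ} (P : Fin l → Monomial p) (i : Fin l)
    (j : Fin (P i).deg) :
    coeffs A P (finSigmaFinEquiv ⟨i, j⟩) =
      (((P i).word j).map (CoeffLetter.toMatrix A)).prod :=
  congrArg (fun q : Σ i, Fin (P i).deg => (((P q.1).word q.2).map _).prod)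
    (Equiv.symm_apply_apply finSigmaFinEquiv (⟨i, j⟩ : Σ i, Fin (P i).deg))

theorem signs_finSigmaFinEquiv {l : ℕ} (P : Fin l → Monomial p) (i : Fin l)
    (j : Fin (P i).deg) : signs P (finSigmaFinEquiv ⟨i, j⟩) = (P i).sign j :=
  congrArg (fun q : Σ i, Fin (P i).deg => (P q.1).sign q.2)
    (Equiv.symm_apply_apply finSigmaFinEquiv (⟨i, j⟩ : Σ i, Fin (P i).deg))

theorem prod_trace_evalPoly {l : ℕ} (U : Matrix.unitaryGroup (Fin N) ℂ)
    (P : Fin l → Monomial p) :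
    ∏ i, (evalPoly A U (P i).toPoly).trace = permTrace (gammaPerm P) fun k =>
      coeffs A P k * ((U ^ (signs P k : ℤ) : Matrix.unitaryGroup (Fin N) ℂ) :
        Matrix (Fin N) (Fin N) ℂ) := by
  rw [permTrace_eq_sum, ← prod_trace_list_ofFn_prod (fun i => (P i).deg_pos) (gammaPerm P)
    finSigmaFinEquiv fun q => by simp [gammaPerm, Equiv.permCongr_apply]]
  simp only [evalPoly_toPoly, coeffs_finSigmaFinEquiv, signs_finSigmaFinEquiv]

end Monomials

end Traces

/-! ## The Schwinger–Dyson equations -/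

section SchwingerDyson

variable {N : ℕ}

instance : (haarUnitary N).IsHaarMeasure := by unfold haarUnitary; infer_instance

instance : IsProbabilityMeasure (haarUnitary N) :=
  ⟨Measure.haarMeasure_self (K₀ :=
    (⊤ : TopologicalSpace.PositiveCompacts (Matrix.unitaryGroup (Fin N) ℂ)))⟩

section Flow

theorem integrable_haarUnitary {f : Matrix.unitaryGroup (Fin N) ℂ → ℂ} (hf : Continuous f) :
    Integrable f (haarUnitary N) :=
  hf.integrable_of_hasCompactSupport (HasCompactSupport.of_compactSpace f)

theorem integral_flow_deriv_eq_zero {g : ℝ → Matrix.unitaryGroup (Fin N) ℂ} (hg : g 0 = 1)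
    {f f' : Matrix.unitaryGroup (Fin N) ℂ → ℂ} (hf : Continuous f) (hf' : Continuous f')
    (hderiv : ∀ t U, HasDerivAt (fun t => f (g t * U)) (f' (g t * U)) t) :
    ∫ U, f' U ∂(haarUnitary N) = 0 := by
  obtain ⟨K, hK⟩ := isCompact_univ.exists_bound_of_continuousOn hf'.continuousOn
  have hderiv_integral : HasDerivAt (fun t => ∫ U, f (g t * U) ∂(haarUnitary N))
      (∫ U, f' (g 0 * U) ∂(haarUnitary N)) 0 :=
    (hasDerivAt_integral_of_dominated_loc_of_deriv_le (s := Set.univ)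
      (F' := fun t U => f' (g t * U)) (bound := fun _ => K) Filter.univ_mem
      (.of_forall fun t =>
        (integrable_haarUnitary (hf.comp (continuous_const_mul _))).aestronglyMeasurable)
      (integrable_haarUnitary (hf.comp (continuous_const_mul _)))
      (integrable_haarUnitary (hf'.comp (continuous_const_mul _))).aestronglyMeasurable
      (.of_forall fun _ _ _ => hK _ (Set.mem_univ _)) (integrable_const K)
      (.of_forall fun U t _ => hderiv t U)).2
  simp only [integral_mul_left_eq_self f, hg, one_mul] at hderiv_integral
  exact hderiv_integral.unique (hasDerivAt_const _ _)

open scoped Matrix.Norms.L2Operator in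
/-- The one-parameter group `t ↦ exp (t X)` of unitary matrices generated by a skew-Hermitian
matrix `X`. -/
def expUnitaryGroup (X : skewAdjoint (Matrix (Fin N) (Fin N) ℂ)) (t : ℝ) :
    Matrix.unitaryGroup (Fin N) ℂ :=
  ⟨NormedSpace.exp (t • (X : Matrix (Fin N) (Fin N) ℂ)),
    let +nondep : NormedAlgebra ℚ (Matrix (Fin N) (Fin N) ℂ) := .restrictScalars ℚ ℂ _
    NormedSpace.exp_mem_unitary_of_mem_skewAdjoint (skewAdjoint.smul_mem t X.2)⟩

theorem expUnitaryGroup_zero (X : skewAdjoint (Matrix (Fin N) (Fin N) ℂ)) :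
    expUnitaryGroup X 0 = 1 :=
  Subtype.ext (by simp [expUnitaryGroup])

open scoped Matrix.Norms.L2Operator in
theorem hasDerivAt_expUnitaryGroup_mul_apply (X : skewAdjoint (Matrix (Fin N) (Fin N) ℂ))
    (U : Matrix.unitaryGroup (Fin N) ℂ) (t : ℝ) (a b : Fin N) :
    HasDerivAt (fun t => (expUnitaryGroup X t * U).1 a b)
      ((X * (expUnitaryGroup X t * U).1 : Matrix (Fin N) (Fin N) ℂ) a b) t := by
  have hexp : HasDerivAt (fun t : ℝ => NormedSpace.exp (t • X.1) * U.1)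
      (X * NormedSpace.exp (t • X.1) * U.1) t :=
    (hasDerivAt_exp_smul_const' (𝕂 := ℝ) X.1 t).mul_const U.1
  rw [mul_assoc] at hexp
  exact hasDerivAt_pi.1 (hasDerivAt_pi.1 hexp a) b

theorem hasDerivAt_conjTranspose_expUnitaryGroup_mul_apply
    (X : skewAdjoint (Matrix (Fin N) (Fin N) ℂ)) (U : Matrix.unitaryGroup (Fin N) ℂ) (t : ℝ)
    (a b : Fin N) :
    HasDerivAt (fun t => (expUnitaryGroup X t * U).1.conjTranspose a b)
      (-((expUnitaryGroup X t * U).1.conjTranspose * X : Matrix (Fin N) (Fin N) ℂ) a b) t := by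
  have h := (hasDerivAt_expUnitaryGroup_mul_apply X U t b a).star
  rwa [← Matrix.conjTranspose_apply, Matrix.conjTranspose_mul, ← Matrix.star_eq_conjTranspose X.1,
    skewAdjoint.mem_iff.1 X.2, Matrix.mul_neg, Matrix.neg_apply] at h

@[fun_prop]
theorem continuous_entry (a b : Fin N) :
    Continuous fun U : Matrix.unitaryGroup (Fin N) ℂ => (U : Matrix (Fin N) (Fin N) ℂ) a b :=
  (continuous_apply_apply a b).comp continuous_subtype_val

end Flow

section EntryMoments

variable {ι κ : Type*} [Fintype ι] [Fintype κ] (i j : ι → Fin N) (i' j' : κ → Fin N)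

/-- The monomial `∏ U_{i(s) j(s)} ∏ (U^*)_{j'(s) i'(s)}` in the entries of `U` and `U^*`. -/
def entryProd (U : Matrix (Fin N) (Fin N) ℂ) : ℂ :=
  (∏ s, U (i s) (j s)) * ∏ s, U.conjTranspose (j' s) (i' s)

/-- The Haar expectation of a monomial in the entries of `U` and `U^*`. -/
def entryMoment : ℂ :=
  ∫ U : Matrix.unitaryGroup (Fin N) ℂ, entryProd i j i' j' U ∂(haarUnitary N)

theorem integrable_entryProd :
    Integrable (fun U : Matrix.unitaryGroup (Fin N) ℂ => entryProd i j i' j' U)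
      (haarUnitary N) :=
  integrable_haarUnitary (by unfold entryProd; fun_prop)

variable [DecidableEq ι] [DecidableEq κ]

/-- The derivative of `entryProd` at `U` in the direction `X U`, for skew-Hermitian `X`; for general
`X` its `ℂ`-linear extension. -/
def entryProdDeriv (X U : Matrix (Fin N) (Fin N) ℂ) : ℂ :=
  (∑ k, (∏ s ∈ Finset.univ.erase k, U (i s) (j s)) * (X * U) (i k) (j k)) *
      (∏ s, U.conjTranspose (j' s) (i' s)) -
    (∏ s, U (i s) (j s)) * ∑ k, (∏ s ∈ Finset.univ.erase k, U.conjTranspose (j' s) (i' s)) *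
      (U.conjTranspose * X) (j' k) (i' k)

theorem continuous_entryProdDeriv (X : Matrix (Fin N) (Fin N) ℂ) :
    Continuous fun U : Matrix.unitaryGroup (Fin N) ℂ => entryProdDeriv i j i' j' X U := by
  unfold entryProdDeriv
  fun_prop

theorem entryProdDeriv_add_smul (X Y U : Matrix (Fin N) (Fin N) ℂ) (c : ℂ) :
    entryProdDeriv i j i' j' (X + c • Y) U =
      entryProdDeriv i j i' j' X U + c * entryProdDeriv i j i' j' Y U := by
  simp only [entryProdDeriv, Matrix.add_mul, Matrix.add_apply, Matrix.smul_mul,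
    Matrix.mul_smul, Matrix.smul_apply, smul_eq_mul, mul_add, Finset.sum_add_distrib,
    mul_left_comm _ c, ← Finset.mul_sum]
  ring

theorem entryProdDeriv_one (U : Matrix (Fin N) (Fin N) ℂ) :
    entryProdDeriv i j i' j' 1 U =
      ((Fintype.card ι : ℂ) - Fintype.card κ) * entryProd i j i' j' U := by
  simp only [entryProdDeriv, Matrix.one_mul, Matrix.mul_one, Finset.prod_erase_mul _ _
    (Finset.mem_univ _), Finset.sum_const, Finset.card_univ, nsmul_eq_mul, entryProd]
  ring

theorem hasDerivAt_entryProd_flow (X : skewAdjoint (Matrix (Fin N) (Fin N) ℂ))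
    (U : Matrix.unitaryGroup (Fin N) ℂ) (t : ℝ) :
    HasDerivAt (fun t => entryProd i j i' j' (expUnitaryGroup X t * U).1)
      (entryProdDeriv i j i' j' X (expUnitaryGroup X t * U).1) t := by
  have h := (HasDerivAt.fun_finsetProd (u := Finset.univ) fun s _ =>
      hasDerivAt_expUnitaryGroup_mul_apply X U t (i s) (j s)).mul
    (HasDerivAt.fun_finsetProd (u := Finset.univ) fun s _ =>
      hasDerivAt_conjTranspose_expUnitaryGroup_mul_apply X U t (j' s) (i' s))
  convert! h using 1
  simp only [entryProdDeriv, smul_eq_mul, mul_neg, Finset.sum_neg_distrib]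
  ring

theorem integral_entryProdDeriv_skewAdjoint (X : skewAdjoint (Matrix (Fin N) (Fin N) ℂ)) :
    ∫ U : Matrix.unitaryGroup (Fin N) ℂ, entryProdDeriv i j i' j' X U ∂(haarUnitary N) = 0 :=
  integral_flow_deriv_eq_zero (f := fun U => entryProd i j i' j' U) (expUnitaryGroup_zero X)
    (by unfold entryProd; fun_prop)
    (continuous_entryProdDeriv i j i' j' X) fun t U => hasDerivAt_entryProd_flow i j i' j' X U t

theorem integral_entryProdDeriv (X : Matrix (Fin N) (Fin N) ℂ) :
    ∫ U : Matrix.unitaryGroup (Fin N) ℂ, entryProdDeriv i j i' j' X U ∂(haarUnitary N) = 0 := by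
  let Y : skewAdjoint (Matrix (Fin N) (Fin N) ℂ) :=
    ⟨Complex.I • (imaginaryPart X : Matrix (Fin N) (Fin N) ℂ),
      (imaginaryPart X).2.smul_mem_skewAdjoint Complex.conj_I⟩
  let Z : skewAdjoint (Matrix (Fin N) (Fin N) ℂ) :=
    ⟨Complex.I • (realPart X : Matrix (Fin N) (Fin N) ℂ),
      (realPart X).2.smul_mem_skewAdjoint Complex.conj_I⟩
  have hX : X = Y + (-Complex.I) • (Z : Matrix (Fin N) (Fin N) ℂ) := by
    conv_lhs => rw [← realPart_add_I_smul_imaginaryPart X]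
    simp [Y, Z, smul_smul, add_comm]
  have hint : ∀ X, Integrable (fun U : Matrix.unitaryGroup (Fin N) ℂ =>
      entryProdDeriv i j i' j' X U) (haarUnitary N) := fun X =>
    integrable_haarUnitary (continuous_entryProdDeriv i j i' j' X)
  rw [hX]
  simp_rw [entryProdDeriv_add_smul]
  rw [integral_add (hint _) ((hint _).const_mul _), integral_const_mul,
    integral_entryProdDeriv_skewAdjoint, integral_entryProdDeriv_skewAdjoint, mul_zero, add_zero]

omit [DecidableEq ι] [DecidableEq κ] in
theorem entryMoment_eq_zero_of_card_ne (h : Fintype.card ι ≠ Fintype.card κ) :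
    entryMoment i j i' j' = 0 := by
  classical
  have hderiv := integral_entryProdDeriv i j i' j' 1
  simp_rw [entryProdDeriv_one] at hderiv
  rw [integral_const_mul] at hderiv
  exact (mul_eq_zero.1 hderiv).resolve_left (sub_ne_zero.2 (mod_cast h))

end EntryMoments

end SchwingerDyson

section MomentRecursion

variable {N m n : ℕ}

theorem prod_erase_eq_prod_succAbove {α : Type*} [CommMonoid α] (f : Fin (m + 1) → α)
    (k : Fin (m + 1)) : ∏ s ∈ Finset.univ.erase k, f s = ∏ s, f (k.succAbove s) := by
  rw [← Finset.compl_singleton, ← Fin.image_succAbove_univ,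
    Finset.prod_image fun _ _ _ _ h => Fin.succAbove_right_injective h]

theorem prod_erase_castSucc {α : Type*} [CommMonoid α] (f : Fin (m + 1) → α) (k : Fin m) :
    ∏ s ∈ Finset.univ.erase k.castSucc, f s =
      (∏ s ∈ Finset.univ.erase k, f s.castSucc) * f (Fin.last m) := by
  have hlast : Finset.univ.erase k.castSucc = insert (Fin.last m)
      ((Finset.univ.erase k).map Fin.castSuccEmb) := by
    ext s
    cases s using Fin.lastCases <;> simp [(Fin.castSucc_lt_last _).ne', (Fin.castSucc_lt_last _).ne]
  rw [hlast, Finset.prod_insert (by simp [(Fin.castSucc_lt_last _).ne]), Finset.prod_map, mul_comm]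
  rfl

theorem prod_swap_last (i j : Fin (m + 1) → Fin N) (U : Matrix (Fin N) (Fin N) ℂ) (k : Fin m) :
    ∏ s, U (i (Equiv.swap k.castSucc (Fin.last m) s)) (j s) =
      (∏ s ∈ Finset.univ.erase k, U (i s.castSucc) (j s.castSucc)) *
        U (i k.castSucc) (j (Fin.last m)) * U (i (Fin.last m)) (j k.castSucc) := by
  have hfix : ∀ s ∈ Finset.univ.erase k,
      U (i (Equiv.swap k.castSucc (Fin.last m) s.castSucc)) (j s.castSucc) =
        U (i s.castSucc) (j s.castSucc) := fun s hs => by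
    rw [Equiv.swap_apply_of_ne_of_ne
      (fun h => Finset.ne_of_mem_erase hs (Fin.castSucc_injective _ h))
      (Fin.castSucc_lt_last s).ne]
  rw [Fin.prod_univ_castSucc, ← Finset.prod_erase_mul _ _ (Finset.mem_univ k),
    Finset.prod_congr rfl hfix, Equiv.swap_apply_left, Equiv.swap_apply_right]
  ring

theorem single_mul_apply_eq_ite (a b x y : Fin N) (U : Matrix (Fin N) (Fin N) ℂ) :
    (Matrix.single a b (1 : ℂ) * U) x y = if x = a then U b y else 0 := by
  simp [Matrix.mul_apply, Matrix.single_apply, ite_and, eq_comm]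

theorem mul_single_apply_eq_ite (a b x y : Fin N) (U : Matrix (Fin N) (Fin N) ℂ) :
    (U * Matrix.single a b (1 : ℂ)) x y = if y = b then U x a else 0 := by
  simp [Matrix.mul_apply, Matrix.single_apply, ite_and, eq_comm]

theorem sum_outgoing_deriv (i j : Fin (m + 1) → Fin N) (U : Matrix (Fin N) (Fin N) ℂ) :
    ∑ a, ∑ k, (∏ s ∈ Finset.univ.erase k, U (Function.update i (Fin.last m) a s) (j s)) *
        (Matrix.single a (i (Fin.last m)) (1 : ℂ) * U) (Function.update i (Fin.last m) a k)
          (j k) =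
      N * (∏ s, U (i s) (j s)) +
        ∑ k : Fin m, ∏ s, U (i (Equiv.swap k.castSucc (Fin.last m) s)) (j s) := by
  have hne : ∀ s : Fin m, s.castSucc ≠ Fin.last m := fun s => (Fin.castSucc_lt_last s).ne
  rw [Finset.sum_comm, Fin.sum_univ_castSucc, add_comm]
  simp only [single_mul_apply_eq_ite, Function.update_self, Function.update_of_ne (hne _), if_true]
  congr 1
  · simp only [prod_erase_eq_prod_succAbove, Fin.succAbove_last, Function.update_of_ne (hne _),
      Finset.sum_const, Finset.card_univ, Fintype.card_fin, nsmul_eq_mul, Fin.prod_univ_castSucc]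
  · simp only [prod_erase_castSucc, Function.update_self, Function.update_of_ne (hne _),
      mul_ite, mul_zero, Finset.sum_ite_eq, Finset.mem_univ, if_true, prod_swap_last]

theorem sum_ingoing_deriv (i j : Fin (m + 1) → Fin N) (i' j' : Fin (n + 1) → Fin N)
    {U : Matrix (Fin N) (Fin N) ℂ} (hU : U.conjTranspose * U = 1) :
    ∑ a, (∏ s, U (Function.update i (Fin.last m) a s) (j s)) *
        ∑ k, (∏ s ∈ Finset.univ.erase k, U.conjTranspose (j' s) (i' s)) *
          (U.conjTranspose * Matrix.single a (i (Fin.last m)) (1 : ℂ)) (j' k) (i' k) =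
      ∑ k with i' k = i (Fin.last m) ∧ j' k = j (Fin.last m), entryProd (i ∘ Fin.castSucc)
        (j ∘ Fin.castSucc) (i' ∘ k.succAbove) (j' ∘ k.succAbove) U := by
  have horth : ∀ k, ∑ a, U.conjTranspose (j' k) a * U a (j (Fin.last m)) =
      if j' k = j (Fin.last m) then 1 else 0 := fun k => by
    rw [← Matrix.mul_apply, hU, Matrix.one_apply]
  simp only [Finset.mul_sum]
  rw [Finset.sum_comm, Finset.sum_filter]
  refine Finset.sum_congr rfl fun k _ => ?_
  calc
    _ = ∑ a, entryProd (i ∘ Fin.castSucc) (j ∘ Fin.castSucc) (i' ∘ k.succAbove)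
          (j' ∘ k.succAbove) U * (if i' k = i (Fin.last m) then 1 else 0) *
          (U.conjTranspose (j' k) a * U a (j (Fin.last m))) := by
      refine Finset.sum_congr rfl fun a _ => ?_
      simp only [mul_single_apply_eq_ite, Fin.prod_univ_castSucc (n := m), Function.update_self,
        Function.update_of_ne (Fin.castSucc_lt_last _).ne, prod_erase_eq_prod_succAbove, entryProd,
        Function.comp_apply]
      split_ifs <;> ring
    _ = _ := by
      rw [← Finset.mul_sum, horth, mul_assoc, ite_zero_mul_ite_zero, one_mul, mul_ite, mul_one,
        mul_zero]

theorem sum_entryProdDeriv (i j : Fin (m + 1) → Fin N) (i' j' : Fin (n + 1) → Fin N)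
    {U : Matrix (Fin N) (Fin N) ℂ} (hU : U.conjTranspose * U = 1) :
    ∑ a, entryProdDeriv (Function.update i (Fin.last m) a) j i' j'
        (Matrix.single a (i (Fin.last m)) 1) U =
      N * entryProd i j i' j' U +
        ∑ k : Fin m, entryProd (i ∘ Equiv.swap k.castSucc (Fin.last m)) j i' j' U -
        ∑ k with i' k = i (Fin.last m) ∧ j' k = j (Fin.last m), entryProd (i ∘ Fin.castSucc)
          (j ∘ Fin.castSucc) (i' ∘ k.succAbove) (j' ∘ k.succAbove) U := by
  simp only [entryProdDeriv, Finset.sum_sub_distrib, ← Finset.sum_mul]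
  rw [sum_outgoing_deriv, sum_ingoing_deriv i j i' j' hU]
  simp only [entryProd, add_mul, Finset.sum_mul, mul_assoc, Function.comp_apply]

-- The Schwinger–Dyson equation for the sum over `a` of the directions `E_{a, i(last)} U`.
theorem entryMoment_recursion (i j : Fin (m + 1) → Fin N) (i' j' : Fin (n + 1) → Fin N) :
    N * entryMoment i j i' j' +
        ∑ k : Fin m, entryMoment (i ∘ Equiv.swap k.castSucc (Fin.last m)) j i' j' =
      ∑ k with i' k = i (Fin.last m) ∧ j' k = j (Fin.last m), entryMoment (i ∘ Fin.castSucc)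
        (j ∘ Fin.castSucc) (i' ∘ k.succAbove) (j' ∘ k.succAbove) := by
  have hsum : ∫ U : Matrix.unitaryGroup (Fin N) ℂ,
      ∑ a, entryProdDeriv (Function.update i (Fin.last m) a) j i' j'
        (Matrix.single a (i (Fin.last m)) 1) U ∂(haarUnitary N) = 0 := by
    rw [integral_finsetSum _ fun a _ => integrable_haarUnitary (continuous_entryProdDeriv ..)]
    exact Finset.sum_eq_zero fun a _ => integral_entryProdDeriv ..
  simp_rw [sum_entryProdDeriv i j i' j' (Matrix.mem_unitaryGroup_iff'.1 (Subtype.prop _))] at hsum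
  rw [integral_sub, integral_add, integral_const_mul, integral_finsetSum, integral_finsetSum,
    sub_eq_zero] at hsum
  · exact hsum
  · exact fun k _ => integrable_entryProd ..
  · exact fun k _ => integrable_entryProd ..
  · exact (integrable_entryProd ..).const_mul _
  · exact integrable_finsetSum _ fun k _ => integrable_entryProd ..
  · exact ((integrable_entryProd ..).const_mul _).add
      (integrable_finsetSum _ fun k _ => integrable_entryProd ..)
  · exact integrable_finsetSum _ fun k _ => integrable_entryProd ..

end MomentRecursion

section Neumann

theorem summable_of_le_add_mul {a b : ℕ → ℝ} {q : ℝ} (ha : ∀ r, 0 ≤ a r) (hb : Summable b)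
    (hb0 : ∀ r, 0 ≤ b r) (hq1 : q < 1) (h0 : a 0 ≤ b 0)
    (hstep : ∀ r, a (r + 1) ≤ b (r + 1) + q * a r) : Summable a := by
  refine summable_of_sum_range_le (c := (∑' r, b r) / (1 - q)) ha fun n => ?_
  have hpartial : ∑ r ∈ Finset.range (n + 1), a r ≤
      ∑ r ∈ Finset.range (n + 1), b r + q * ∑ r ∈ Finset.range n, a r := by
    rw [Finset.sum_range_succ', Finset.sum_range_succ', Finset.mul_sum, add_right_comm,
      ← Finset.sum_add_distrib]
    exact add_le_add (Finset.sum_le_sum fun r _ => hstep r) h0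
  have hlast : ∑ r ∈ Finset.range n, a r ≤ ∑ r ∈ Finset.range (n + 1), a r :=
    Finset.sum_le_sum_of_subset_of_nonneg (Finset.range_mono n.le_succ) fun r _ _ => ha r
  have htotal : ∑ r ∈ Finset.range (n + 1), b r ≤ ∑' r, b r :=
    hb.sum_le_tsum _ fun r _ => hb0 r
  rw [le_div_iff₀ (sub_pos.2 hq1)]
  linarith

theorem hasSum_of_neumann_recursion {𝕜 V : Type*} [NontriviallyNormedField 𝕜]
    [NormedAddCommGroup V] [NormedSpace 𝕜 V] [CompleteSpace V] {T : V →L[𝕜] V} (hT : ‖T‖ < 1)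
    {X R : ℕ → V} {E : V} (h0 : X 0 = R 0) (hstep : ∀ r, X (r + 1) = R (r + 1) + T (X r))
    (hR : Summable fun r => ‖R r‖) (hE : HasSum R (E - T E)) : HasSum X E := by
  have hX : Summable X := by
    refine .of_norm (summable_of_le_add_mul (fun r => norm_nonneg _) hR (fun r => norm_nonneg _) hT
      (by rw [h0]) fun r => ?_)
    rw [hstep]
    exact (norm_add_le _ _).trans (by gcongr; exact T.le_opNorm _)
  obtain ⟨Y, hY⟩ := hX
  have hfix : T (E - Y) = E - Y := by
    have htail := ((hasSum_nat_add_iff' 1).2 hE).add (T.hasSum hY)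
    simp_rw [← hstep] at htail
    have := htail.unique ((hasSum_nat_add_iff' 1).2 hY)
    simp only [Finset.sum_range_one, h0] at this
    rw [map_sub, ← sub_eq_zero, ← neg_eq_zero, ← sub_eq_zero.2 this]
    abel
  have hzero : E - Y = 0 := by
    by_contra hne
    have hle := hfix ▸ T.le_opNorm (E - Y)
    exact hle.not_gt (mul_lt_of_lt_one_left (norm_pos_iff.2 hne) hT)
  rwa [sub_eq_zero.1 hzero]

end Neumann

/-! ## Monotone walks -/

theorem viaEmbedding_swap {α β : Type*} [DecidableEq α] [DecidableEq β] (f : α ↪ β) (a b : α) :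
    (Equiv.swap a b).viaEmbedding f = Equiv.swap (f a) (f b) := by
  ext x
  by_cases hx : x ∈ Set.range f
  · obtain ⟨x, rfl⟩ := hx
    rw [Equiv.Perm.viaEmbedding_apply, f.injective.map_swap]
  · rw [Equiv.Perm.viaEmbedding_apply_of_notMem _ _ _ hx, Equiv.swap_apply_of_ne_of_ne] <;>
      exact fun h => hx ⟨_, h.symm⟩

/-- A monotone walk in the symmetric group of `S`: a sequence of transpositions `(a_t b_t)` with
`a_t < b_t` and `b_t` nondecreasing, recorded as the pairs `(a_t, b_t)`. -/
@[ext]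
structure MonotoneWalk (S : Type*) [LinearOrder S] (r : ℕ) where
  seq : Fin r → S × S
  lt : ∀ t, (seq t).1 < (seq t).2
  mono : Monotone fun t => (seq t).2

namespace MonotoneWalk

variable {S S' : Type*} [LinearOrder S] [LinearOrder S'] {m r : ℕ}

instance [Finite S] : Finite (MonotoneWalk S r) :=
  Finite.of_injective MonotoneWalk.seq fun _ _ h => MonotoneWalk.ext h

instance [Finite S] : Fintype (MonotoneWalk S r) := Fintype.ofFinite _

instance : Unique (MonotoneWalk S 0) where
  default := ⟨Fin.elim0, fun t => t.elim0, fun t => t.elim0⟩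
  uniq _ := MonotoneWalk.ext (Subsingleton.elim _ _)

instance [IsEmpty S] : IsEmpty (MonotoneWalk S (r + 1)) :=
  ⟨fun τ => isEmptyElim (τ.seq 0).1⟩

/-- The endpoint `(a_0 b_0) (a_1 b_1) ⋯` of a walk starting at the identity. -/
def perm (τ : MonotoneWalk S r) : Equiv.Perm S :=
  (List.ofFn fun t => Equiv.swap (τ.seq t).1 (τ.seq t).2).prod

theorem perm_eq_one_of_length_zero (τ : MonotoneWalk S 0) : τ.perm = 1 := by
  simp [perm]

/-- The image of a walk under a strictly increasing map of the ground set. -/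
def map (f : S ↪o S') (τ : MonotoneWalk S r) : MonotoneWalk S' r where
  seq t := (f (τ.seq t).1, f (τ.seq t).2)
  lt t := f.lt_iff_lt.2 (τ.lt t)
  mono := f.monotone.comp τ.mono

theorem perm_map (f : S ↪o S') (τ : MonotoneWalk S r) :
    (τ.map f).perm = τ.perm.viaEmbedding f.toEmbedding := by
  rw [perm, perm, ← Equiv.Perm.viaEmbeddingHom_apply, map_list_prod, List.map_ofFn]
  exact congrArg (fun w => (List.ofFn w).prod)
    (funext fun t => (viaEmbedding_swap f.toEmbedding _ _).symm)

theorem map_injective (f : S ↪o S') : Function.Injective (map (r := r) f) := fun _ _ h =>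
  MonotoneWalk.ext <| (f.injective.prodMap f.injective).comp_left
    (congrArg MonotoneWalk.seq h)

theorem exists_map_eq (f : S ↪o S') {τ : MonotoneWalk S' r}
    (h : ∀ t, ∃ x, Prod.map f f x = τ.seq t) : ∃ τ' : MonotoneWalk S r, τ'.map f = τ := by
  choose seq hseq using h
  simp only [Prod.map_apply', Prod.ext_iff] at hseq
  exact ⟨⟨seq, fun t => f.lt_iff_lt.1 (by simpa only [hseq] using τ.lt t),
    fun t u htu => f.le_iff_le.1 (by simpa only [hseq] using τ.mono htu)⟩,
    MonotoneWalk.ext (funext fun t => Prod.ext (hseq t).1 (hseq t).2)⟩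

/-- The walk `τ` followed by the transposition `(k m)`. -/
def snocLast (τ : MonotoneWalk (Fin (m + 1)) r) (k : Fin m) :
    MonotoneWalk (Fin (m + 1)) (r + 1) where
  seq := Fin.snoc (α := fun _ => Fin (m + 1) × Fin (m + 1)) τ.seq (k.castSucc, Fin.last m)
  lt t := by
    cases t using Fin.lastCases with
    | last => simpa only [Fin.snoc_last] using Fin.castSucc_lt_last k
    | cast t => simpa only [Fin.snoc_castSucc] using τ.lt t
  mono t u h := by
    cases u using Fin.lastCases with
    | last => simpa only [Fin.snoc_last] using Fin.le_last _
    | cast u =>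
      cases t using Fin.lastCases with
      | last => exact absurd h (Fin.castSucc_lt_last u).not_ge
      | cast t => simpa only [Fin.snoc_castSucc] using τ.mono (Fin.castSucc_le_castSucc_iff.1 h)

theorem seq_snocLast_last (τ : MonotoneWalk (Fin (m + 1)) r) (k : Fin m) :
    (τ.snocLast k).seq (Fin.last r) = (k.castSucc, Fin.last m) :=
  Fin.snoc_last (α := fun _ => Fin (m + 1) × Fin (m + 1)) _ _

theorem seq_snocLast_castSucc (τ : MonotoneWalk (Fin (m + 1)) r) (k : Fin m) (t : Fin r) :
    (τ.snocLast k).seq t.castSucc = τ.seq t :=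
  Fin.snoc_castSucc (α := fun _ => Fin (m + 1) × Fin (m + 1)) _ _ _

theorem perm_snocLast (τ : MonotoneWalk (Fin (m + 1)) r) (k : Fin m) :
    (τ.snocLast k).perm = τ.perm * Equiv.swap k.castSucc (Fin.last m) := by
  simp only [perm, List.ofFn_succ', List.concat_eq_append, List.prod_append, List.prod_singleton,
    seq_snocLast_last, seq_snocLast_castSucc]

theorem snocLast_injective :
    Function.Injective fun x : Fin m × MonotoneWalk (Fin (m + 1)) r => x.2.snocLast x.1 := by
  rintro ⟨k, τ⟩ ⟨k', τ'⟩ h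
  have hseq := fun t => congrFun (congrArg MonotoneWalk.seq h) t
  have hlast := hseq (Fin.last r)
  simp only [seq_snocLast_last, Prod.mk.injEq, Fin.castSucc_inj, and_true] at hlast
  exact Prod.ext hlast (MonotoneWalk.ext (funext fun t => by
    simpa only [seq_snocLast_castSucc] using hseq t.castSucc))

theorem exists_snocLast_eq {τ : MonotoneWalk (Fin (m + 1)) (r + 1)}
    (h : (τ.seq (Fin.last r)).2 = Fin.last m) :
    ∃ (k : Fin m) (τ' : MonotoneWalk (Fin (m + 1)) r), τ'.snocLast k = τ := by
  obtain ⟨k, hk⟩ : ∃ k : Fin m, k.castSucc = (τ.seq (Fin.last r)).1 :=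
    Fin.exists_castSucc_eq.2 (h ▸ τ.lt (Fin.last r)).ne
  refine ⟨k, ⟨fun t => τ.seq t.castSucc, fun t => τ.lt _,
    fun t u htu => τ.mono (Fin.castSucc_le_castSucc_iff.2 htu)⟩,
    MonotoneWalk.ext (funext fun t => ?_)⟩
  cases t using Fin.lastCases with
  | last => rw [seq_snocLast_last, hk, ← h]
  | cast t => rw [seq_snocLast_castSucc]

theorem exists_map_castSucc_eq {τ : MonotoneWalk (Fin (m + 1)) (r + 1)}
    (h : (τ.seq (Fin.last r)).2 ≠ Fin.last m) :
    ∃ τ' : MonotoneWalk (Fin m) (r + 1), τ'.map Fin.castSuccOrderEmb = τ := by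
  have hsnd : ∀ t, (τ.seq t).2 < Fin.last m := fun t =>
    (τ.mono (Fin.le_last t)).trans_lt (Fin.lt_last_iff_ne_last.2 h)
  refine exists_map_eq _ fun t => ?_
  obtain ⟨a, ha⟩ := Fin.exists_castSucc_eq.2 ((τ.lt t).trans (hsnd t)).ne
  obtain ⟨b, hb⟩ := Fin.exists_castSucc_eq.2 (hsnd t).ne
  exact ⟨(a, b), Prod.ext ha hb⟩

theorem snocLast_elim_map_bijective (m r : ℕ) : Function.Bijective
    (Sum.elim (fun x : Fin m × MonotoneWalk (Fin (m + 1)) r => x.2.snocLast x.1)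
      (fun τ : MonotoneWalk (Fin m) (r + 1) => τ.map Fin.castSuccOrderEmb)) := by
  refine ⟨snocLast_injective.sumElim (map_injective _) fun x τ h => ?_, fun τ => ?_⟩
  · have hlast := congrArg (fun τ => (τ.seq (Fin.last r)).2) h
    simp only [seq_snocLast_last] at hlast
    exact (Fin.castSucc_lt_last _).ne' hlast
  · by_cases h : (τ.seq (Fin.last r)).2 = Fin.last m
    · obtain ⟨k, τ', rfl⟩ := exists_snocLast_eq h
      exact ⟨.inl (k, τ'), rfl⟩
    · obtain ⟨τ', rfl⟩ := exists_map_castSucc_eq h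
      exact ⟨.inr τ', rfl⟩

end MonotoneWalk

/-! ## The expansion of the moments of the entries -/

section PermOfLast

variable {m : ℕ}

/-- The permutation of `Fin (m + 1)` sending the last element to `k` and acting as `π` between the
complements. -/
def permOfLast (x : Fin (m + 1) × Equiv.Perm (Fin m)) : Equiv.Perm (Fin (m + 1)) :=
  (finSuccEquivLast.trans (Equiv.optionCongr x.2)).trans (finSuccEquiv' x.1).symm

theorem permOfLast_last (x : Fin (m + 1) × Equiv.Perm (Fin m)) :
    permOfLast x (Fin.last m) = x.1 := by
  simp [permOfLast]

theorem permOfLast_castSucc (x : Fin (m + 1) × Equiv.Perm (Fin m)) (s : Fin m) :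
    permOfLast x s.castSucc = x.1.succAbove (x.2 s) := by
  simp [permOfLast]

theorem permOfLast_bijective : Function.Bijective (permOfLast (m := m)) := by
  rw [Fintype.bijective_iff_injective_and_card]
  refine ⟨fun x x' h => ?_, by simp [Fintype.card_perm, Nat.factorial_succ]⟩
  obtain ⟨k, π⟩ := x
  obtain ⟨k', π'⟩ := x'
  obtain rfl : k = k' := by
    simpa only [permOfLast_last] using congrArg (fun e => e (Fin.last m)) h
  refine Prod.ext rfl (Equiv.ext fun s => Fin.succAbove_right_injective (p := k) ?_)
  simpa only [permOfLast_castSucc] using congrArg (fun e => e s.castSucc) h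

end PermOfLast

section MonotoneCount

variable {N m r : ℕ} {S S' : Type*}

section MatchCount

variable [Fintype S] [DecidableEq S] [Fintype S'] [DecidableEq S']

/-- The number of bijections `π` with `i' ∘ π = i ∘ σ⁻¹` and `j' ∘ π = j`. -/
def matchCount (σ : Equiv.Perm S) (i j : S → Fin N) (i' j' : S' → Fin N) : ℕ :=
  (Finset.univ.filter fun π : S ≃ S' => ∀ s, i' (π s) = i (σ⁻¹ s) ∧ j' (π s) = j s).card

theorem matchCount_mul_swap (σ : Equiv.Perm S) (a b : S) (i j : S → Fin N) (i' j' : S' → Fin N) :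
    matchCount (σ * Equiv.swap a b) i j i' j' = matchCount σ (i ∘ Equiv.swap a b) j i' j' := by
  simp only [matchCount, mul_inv_rev, Equiv.swap_inv, Equiv.Perm.mul_apply, Function.comp_apply]

theorem matchCount_viaEmbedding_castSucc (σ : Equiv.Perm (Fin m))
    (i j i' j' : Fin (m + 1) → Fin N) :
    matchCount (σ.viaEmbedding Fin.castSuccEmb) i j i' j' =
      ∑ k with i' k = i (Fin.last m) ∧ j' k = j (Fin.last m),
        matchCount σ (i ∘ Fin.castSucc) (j ∘ Fin.castSucc) (i' ∘ k.succAbove)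
          (j' ∘ k.succAbove) := by
  have hinv : (σ.viaEmbedding Fin.castSuccEmb)⁻¹ = σ⁻¹.viaEmbedding Fin.castSuccEmb := rfl
  have hlast : (σ⁻¹.viaEmbedding Fin.castSuccEmb) (Fin.last m) = Fin.last m :=
    Equiv.Perm.viaEmbedding_apply_of_notMem _ _ _ fun ⟨s, hs⟩ => (Fin.castSucc_lt_last s).ne hs
  have hcast : ∀ s : Fin m, (σ⁻¹.viaEmbedding Fin.castSuccEmb) s.castSucc = (σ⁻¹ s).castSucc :=
    fun s => Equiv.Perm.viaEmbedding_apply σ⁻¹ Fin.castSuccEmb s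
  simp only [matchCount, Finset.card_filter]
  rw [← permOfLast_bijective.sum_comp, Fintype.sum_prod_type, Finset.sum_filter]
  refine Finset.sum_congr rfl fun k _ => ?_
  simp only [Fin.forall_fin_succ', permOfLast_last, permOfLast_castSucc, hinv, hlast, hcast,
    Function.comp_apply]
  split_ifs with h
  · simp only [h, and_true]
    congr!
  · simp only [h, and_false, if_false, Finset.sum_const_zero]

end MatchCount

/-- The number of pairs of a monotone walk of length `r` in the permutations of `S`, with endpoint
`σ`, and of a bijection `π` with `i' ∘ π = i ∘ σ⁻¹` and `j' ∘ π = j`. -/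
def monotoneCount [Fintype S] [LinearOrder S] [Fintype S'] [DecidableEq S'] (r : ℕ)
    (i j : S → Fin N) (i' j' : S' → Fin N) : ℕ :=
  ∑ τ : MonotoneWalk S r, matchCount τ.perm i j i' j'

theorem sum_matchCount_perm_map_castSucc (i j i' j' : Fin (m + 1) → Fin N) :
    ∑ τ : MonotoneWalk (Fin m) r, matchCount (τ.map Fin.castSuccOrderEmb).perm i j i' j' =
      ∑ k with i' k = i (Fin.last m) ∧ j' k = j (Fin.last m),
        monotoneCount r (i ∘ Fin.castSucc) (j ∘ Fin.castSucc) (i' ∘ k.succAbove)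
          (j' ∘ k.succAbove) := by
  simp only [monotoneCount]
  rw [Finset.sum_comm]
  exact Finset.sum_congr rfl fun τ _ => by
    rw [τ.perm_map]
    exact matchCount_viaEmbedding_castSucc ..

theorem monotoneCount_zero_fin_succ (i j i' j' : Fin (m + 1) → Fin N) :
    monotoneCount 0 i j i' j' =
      ∑ k with i' k = i (Fin.last m) ∧ j' k = j (Fin.last m),
        monotoneCount 0 (i ∘ Fin.castSucc) (j ∘ Fin.castSucc) (i' ∘ k.succAbove)
          (j' ∘ k.succAbove) := by
  rw [← sum_matchCount_perm_map_castSucc, monotoneCount]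
  simp only [Fintype.sum_unique, MonotoneWalk.perm_eq_one_of_length_zero]

theorem monotoneCount_succ_fin_succ (i j i' j' : Fin (m + 1) → Fin N) :
    monotoneCount (r + 1) i j i' j' =
      ∑ k : Fin m, monotoneCount r (i ∘ Equiv.swap k.castSucc (Fin.last m)) j i' j' +
      ∑ k with i' k = i (Fin.last m) ∧ j' k = j (Fin.last m),
        monotoneCount (r + 1) (i ∘ Fin.castSucc) (j ∘ Fin.castSucc) (i' ∘ k.succAbove)
          (j' ∘ k.succAbove) := by
  rw [← sum_matchCount_perm_map_castSucc, monotoneCount,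
    ← (MonotoneWalk.snocLast_elim_map_bijective m r).sum_comp, Fintype.sum_sum_type,
    Fintype.sum_prod_type]
  simp only [Sum.elim_inl, Sum.elim_inr, MonotoneWalk.perm_snocLast, matchCount_mul_swap,
    monotoneCount]

variable {T T' : Type*} [Fintype S] [LinearOrder S] [Fintype S'] [DecidableEq S'] [Fintype T]
  [LinearOrder T] [Fintype T'] [DecidableEq T']

theorem monotoneCount_comp_equiv (e : T ≃o S) (e' : T' ≃ S') (i j : S → Fin N)
    (i' j' : S' → Fin N) :
    monotoneCount r (i ∘ e) (j ∘ e) (i' ∘ e') (j' ∘ e') = monotoneCount r i j i' j' := by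
  have hbij : Function.Bijective (MonotoneWalk.map (r := r) e.toOrderEmbedding) :=
    ⟨MonotoneWalk.map_injective _, fun τ => MonotoneWalk.exists_map_eq _ fun t =>
      ⟨(e.symm (τ.seq t).1, e.symm (τ.seq t).2), by simp⟩⟩
  have hperm : ∀ (τ : MonotoneWalk T r) t,
      (τ.map e.toOrderEmbedding).perm⁻¹ (e t) = e (τ.perm⁻¹ t) := fun τ t => by
    rw [τ.perm_map]
    exact Equiv.Perm.viaEmbedding_apply τ.perm⁻¹ e.toOrderEmbedding.toEmbedding t
  have hcongr : ∀ (π : T ≃ T') t, Equiv.equivCongr e.toEquiv e' π (e t) = e' (π t) := by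
    simp [Equiv.equivCongr]
  unfold monotoneCount
  rw [← hbij.sum_comp]
  refine Finset.sum_congr rfl fun τ _ => ?_
  refine Finset.card_equiv (Equiv.equivCongr e.toEquiv e') fun π => ?_
  simp only [Finset.mem_filter, Finset.mem_univ, true_and, e.surjective.forall, hperm,
    hcongr, Function.comp_apply]

theorem monotoneCount_eq_zero_of_card_ne (h : Fintype.card S ≠ Fintype.card S')
    (i j : S → Fin N) (i' j' : S' → Fin N) : monotoneCount r i j i' j' = 0 :=
  Finset.sum_eq_zero fun τ _ => by
    have : IsEmpty (S ≃ S') := ⟨fun π => h (Fintype.card_congr π)⟩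
    simp [matchCount]

end MonotoneCount

section Expansion

variable {N m : ℕ}

/-- The operator `F ↦ -N⁻¹ ∑ k < m, F (· ∘ (k m))` whose Neumann series inverts the Schwinger–Dyson
recursion. -/
def lastSwapOperator (N m : ℕ) :
    ((Fin (m + 1) → Fin N) → ℂ) →L[ℂ] ((Fin (m + 1) → Fin N) → ℂ) :=
  ContinuousLinearMap.pi fun i => (-(N : ℂ)⁻¹) • ∑ k : Fin m,
    ContinuousLinearMap.proj (i ∘ Equiv.swap k.castSucc (Fin.last m))

theorem lastSwapOperator_apply (F : (Fin (m + 1) → Fin N) → ℂ) (i : Fin (m + 1) → Fin N) :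
    lastSwapOperator N m F i =
      -(N : ℂ)⁻¹ * ∑ k : Fin m, F (i ∘ Equiv.swap k.castSucc (Fin.last m)) := by
  simp [lastSwapOperator]

theorem norm_lastSwapOperator_lt_one (h : m < N) : ‖lastSwapOperator N m‖ < 1 := by
  have hN : (0 : ℝ) < N := mod_cast m.zero_le.trans_lt h
  refine (ContinuousLinearMap.opNorm_le_bound _ (by positivity) fun F =>
    (pi_norm_le_iff_of_nonneg (by positivity)).2 fun i => ?_).trans_lt
      ((div_lt_one hN).2 (Nat.cast_lt.2 h))
  calc
    _ = (N : ℝ)⁻¹ * ‖∑ k : Fin m, F (i ∘ Equiv.swap k.castSucc (Fin.last m))‖ := by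
      rw [lastSwapOperator_apply, norm_mul, norm_neg, norm_inv, Complex.norm_natCast]
    _ ≤ (N : ℝ)⁻¹ * (m * ‖F‖) := by
      gcongr
      simpa using norm_sum_le_of_le Finset.univ fun (k : Fin m) _ => norm_le_pi_norm F _
    _ = m / N * ‖F‖ := by ring

/-- The term of order `r` of the expansion of `entryMoment i j i' j'`, in the balanced case. -/
def expansionTerm {S S' : Type*} [Fintype S] [LinearOrder S] [Fintype S'] [DecidableEq S'] (r : ℕ)
    (i j : S → Fin N) (i' j' : S' → Fin N) : ℂ :=
  (-1) ^ r / (N : ℂ) ^ (r + Fintype.card S) * monotoneCount r i j i' j'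

theorem expansionTerm_zero_fin_succ (i j i' j' : Fin (m + 1) → Fin N) :
    expansionTerm 0 i j i' j' =
      (N : ℂ)⁻¹ * ∑ k with i' k = i (Fin.last m) ∧ j' k = j (Fin.last m),
        expansionTerm 0 (i ∘ Fin.castSucc) (j ∘ Fin.castSucc) (i' ∘ k.succAbove)
          (j' ∘ k.succAbove) := by
  simp only [expansionTerm, monotoneCount_zero_fin_succ i, Fintype.card_fin, ← Finset.mul_sum,
    Nat.cast_sum]
  field_simp
  ring

theorem expansionTerm_succ_fin_succ (r : ℕ) (i j i' j' : Fin (m + 1) → Fin N) :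
    expansionTerm (r + 1) i j i' j' =
      (N : ℂ)⁻¹ * (∑ k with i' k = i (Fin.last m) ∧ j' k = j (Fin.last m),
        expansionTerm (r + 1) (i ∘ Fin.castSucc) (j ∘ Fin.castSucc) (i' ∘ k.succAbove)
          (j' ∘ k.succAbove)) +
      lastSwapOperator N m (fun i => expansionTerm r i j i' j') i := by
  simp only [expansionTerm, monotoneCount_succ_fin_succ i, Fintype.card_fin, ← Finset.mul_sum,
    Nat.cast_sum, Nat.cast_add, lastSwapOperator_apply]
  field_simp
  ring

theorem entryMoment_sub_lastSwapOperator (hN : N ≠ 0) (i j i' j' : Fin (m + 1) → Fin N) :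
    entryMoment i j i' j' - lastSwapOperator N m (fun i => entryMoment i j i' j') i =
      (N : ℂ)⁻¹ * ∑ k with i' k = i (Fin.last m) ∧ j' k = j (Fin.last m),
        entryMoment (i ∘ Fin.castSucc) (j ∘ Fin.castSucc) (i' ∘ k.succAbove)
          (j' ∘ k.succAbove) := by
  rw [← entryMoment_recursion, lastSwapOperator_apply]
  field_simp
  ring

theorem hasSum_expansionTerm_fin (hN : N ≠ 0) (hm : m ≤ N) (i j i' j' : Fin m → Fin N) :
    HasSum (fun r => expansionTerm r i j i' j') (entryMoment i j i' j') := by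
  induction m with
  | zero =>
    have hpos : ∀ r, r ≠ 0 → expansionTerm r i j i' j' = 0 := fun r hr => by
      obtain ⟨r, rfl⟩ := Nat.exists_eq_succ_of_ne_zero hr
      simp [expansionTerm, monotoneCount]
    have hzero : expansionTerm 0 i j i' j' = entryMoment i j i' j' := by
      simp [expansionTerm, monotoneCount, matchCount, entryMoment, entryProd]
    exact hzero ▸ hasSum_single 0 hpos
  | succ m ih =>
    let R (r : ℕ) (i : Fin (m + 1) → Fin N) : ℂ :=
      (N : ℂ)⁻¹ * ∑ k with i' k = i (Fin.last m) ∧ j' k = j (Fin.last m),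
        expansionTerm r (i ∘ Fin.castSucc) (j ∘ Fin.castSucc) (i' ∘ k.succAbove)
          (j' ∘ k.succAbove)
    let E (i : Fin (m + 1) → Fin N) : ℂ := entryMoment i j i' j'
    have hE : HasSum R (E - lastSwapOperator N m E) := Pi.hasSum.2 fun i => by
      rw [Pi.sub_apply, entryMoment_sub_lastSwapOperator hN]
      exact (hasSum_sum fun k _ => ih (by omega) _ _ _ _).mul_left _
    exact Pi.hasSum.1 (hasSum_of_neumann_recursion (norm_lastSwapOperator_lt_one (by omega))
      (X := fun r i => expansionTerm r i j i' j')
      (funext fun i => expansionTerm_zero_fin_succ i j i' j')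
      (fun r => funext fun i => expansionTerm_succ_fin_succ r i j i' j') hE.summable.norm hE) i

variable {S S' : Type*} [Fintype S] [LinearOrder S] [Fintype S'] [DecidableEq S']

theorem hasSum_expansionTerm (hN : N ≠ 0) (hcard : Fintype.card S = Fintype.card S')
    (hS : Fintype.card S ≤ N) (i j : S → Fin N) (i' j' : S' → Fin N) :
    HasSum (fun r => expansionTerm r i j i' j') (entryMoment i j i' j') := by
  let e : Fin (Fintype.card S) ≃o S := Fintype.orderIsoFinOfCardEq S rfl
  let e' : Fin (Fintype.card S) ≃ S' := (Fintype.equivFinOfCardEq hcard.symm).symm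
  have hterm : ∀ r, expansionTerm r (i ∘ e) (j ∘ e) (i' ∘ e') (j' ∘ e') =
      expansionTerm r i j i' j' := fun r => by
    rw [expansionTerm, monotoneCount_comp_equiv, Fintype.card_fin, expansionTerm]
  have hmoment : entryMoment (i ∘ e) (j ∘ e) (i' ∘ e') (j' ∘ e') = entryMoment i j i' j' :=
    integral_congr_ae <| .of_forall fun U =>
      congrArg₂ (· * ·) (e.toEquiv.prod_comp fun s => (U : Matrix (Fin N) (Fin N) ℂ) (i s) (j s))
        (e'.prod_comp fun s => (U : Matrix (Fin N) (Fin N) ℂ).conjTranspose (j' s) (i' s))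
  simpa only [hterm, hmoment] using 
    hasSum_expansionTerm_fin hN hS (i ∘ e) (j ∘ e) (i' ∘ e') (j' ∘ e')

-- When the numbers of entries of `U` and `U^*` differ, both sides vanish.
theorem hasSum_entryMoment (hN : N ≠ 0)
    (hS : ((Fintype.card S + Fintype.card S' : ℕ) : ℝ) / 2 ≤ N) (i j : S → Fin N)
    (i' j' : S' → Fin N) :
    HasSum (fun r : ℕ => (((-1) ^ r /
        (N : ℝ) ^ ((r : ℝ) + ((Fintype.card S + Fintype.card S' : ℕ) : ℝ) / 2) : ℝ) : ℂ) *
      monotoneCount r i j i' j') (entryMoment i j i' j') := by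
  by_cases hcard : Fintype.card S = Fintype.card S'
  · have hhalf : ((Fintype.card S + Fintype.card S' : ℕ) : ℝ) / 2 = Fintype.card S := by
      rw [← hcard]
      push_cast
      ring
    rw [hhalf] at hS ⊢
    convert! hasSum_expansionTerm hN hcard (mod_cast hS) i j i' j' using 2 with r
    rw [expansionTerm, ← Nat.cast_add, Real.rpow_natCast]
    push_cast
    rfl
  · simp only [monotoneCount_eq_zero_of_card_ne hcard, Nat.cast_zero, mul_zero,
      entryMoment_eq_zero_of_card_ne i j i' j' hcard]
    exact hasSum_zero

end Expansion

/-! ## The strands of a map -/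

section Labels

variable {I : Type*} (ε : I → ℤˣ)

/-- The labels of the outgoing white half-edges of a map with signs `ε`. -/
abbrev OutLabel : Type _ := {i // ε i = 1}

/-- The labels of the ingoing white half-edges of a map with signs `ε`. -/
abbrev InLabel : Type _ := {i // ε i = -1}

/-- Each label is either outgoing or ingoing. -/
def labelEquiv : OutLabel ε ⊕ InLabel ε ≃ I :=
  (Equiv.sumCongr (Equiv.refl _)
    (Equiv.subtypeEquivRight fun _ => Int.units_ne_iff_eq_neg.symm)).trans
      (Equiv.sumCompl fun i => ε i = 1)

end Labels

namespace UnitaryMap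

variable {I : Type} {r : ℕ}

section BlackVertices

variable (C : UnitaryMap I r)

theorem vertex_eq_iff {h h' : C.HalfEdge} :
    C.vertex h = C.vertex h' ↔ C.next.SameCycle h h' :=
  Quotient.eq (r := Equiv.Perm.SameCycle.setoid C.next)

theorem minimalPeriod_next {h : C.HalfEdge} (hb : C.IsBlack (C.vertex h)) :
    Function.minimalPeriod C.next h = 4 := by
  let turn (k : Fin (Function.minimalPeriod C.next h)) : {h' // C.vertex h' = C.vertex h} :=
    ⟨(C.next ^ (k : ℕ)) h, C.vertex_eq_iff.2 (Equiv.Perm.SameCycle.symm ⟨(k : ℕ), by simp⟩)⟩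
  have hturn : Function.Bijective turn := by
    constructor
    · intro k k' hk
      exact Fin.ext (Function.iterate_injOn_Iio_minimalPeriod k.2 k'.2
        (by simpa only [turn, Equiv.Perm.coe_pow] using congrArg Subtype.val hk))
    · rintro ⟨h', hh'⟩
      obtain ⟨n, -, rfl⟩ := (C.vertex_eq_iff.1 hh').symm.exists_pow_eq'
      refine ⟨⟨n % _, Nat.mod_lt _ (minimalPeriod_perm_pos C.next h)⟩, Subtype.ext ?_⟩
      simp only [turn, Equiv.Perm.coe_pow]
      exact Function.iterate_mod_minimalPeriod_eq
  rw [← C.degree_black _ hb, ← Nat.card_eq_of_bijective turn hturn, Nat.card_fin]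

theorem next_next_ne {h : C.HalfEdge} (hb : C.IsBlack (C.vertex h)) :
    C.next (C.next h) ≠ h := by
  intro hc
  have hdvd := Function.IsPeriodicPt.minimalPeriod_dvd (f := C.next) (n := 2) (x := h) hc
  rw [C.minimalPeriod_next hb] at hdvd
  exact absurd hdvd (by decide)

theorem eq_of_vertex_eq {h h' : C.HalfEdge} (hb : C.IsBlack (C.vertex h))
    (hh : C.vertex h' = C.vertex h) :
    h' = h ∨ h' = C.next h ∨ h' = C.next (C.next h) ∨ h' = C.next (C.next (C.next h)) := by
  obtain ⟨n, -, rfl⟩ := (C.vertex_eq_iff.1 hh).symm.exists_pow_eq'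
  rw [Equiv.Perm.coe_pow, ← Function.iterate_mod_minimalPeriod_eq, C.minimalPeriod_next hb]
  have hlt : n % 4 < 4 := Nat.mod_lt _ (by norm_num)
  interval_cases n % 4 <;> simp

theorem next_next_eq {h h' : C.HalfEdge} (hb : C.IsBlack (C.vertex h))
    (hv : C.vertex h' = C.vertex h) (hs : C.sign h' = C.sign h) (hne : h' ≠ h) :
    C.next (C.next h) = h' := by
  have hne_neg : ∀ u : ℤˣ, -u ≠ u := by decide
  have hsign : C.sign (C.next h) = -C.sign h := C.alternated_black h hb
  have hsign' : C.sign (C.next (C.next (C.next h))) = -C.sign h := by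
    rw [C.alternated_black _ (by rwa [C.vertex_next, C.vertex_next]),
      C.alternated_black _ (by rwa [C.vertex_next]), hsign, neg_neg]
  rcases C.eq_of_vertex_eq hb hv with rfl | rfl | rfl | rfl
  · exact absurd rfl hne
  · exact absurd (hsign.symm.trans hs) (hne_neg _)
  · rfl
  · exact absurd (hsign'.symm.trans hs) (hne_neg _)

theorem isBlack_of_eq {h : C.HalfEdge} {k : Fin r} (hk : C.vertex h = C.black k) :
    C.IsBlack (C.vertex h) := hk ▸ (C.black k).2

theorem black_injective {k l : Fin r} (h : (C.black k : C.Vertex) = C.black l) : k = l :=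
  C.black.injective (Subtype.ext h)

theorem white_injective {i j : I} (h : (C.white i : C.HalfEdge) = C.white j) : i = j :=
  C.white.injective (Subtype.ext h)

theorem isWhite_white (i : I) : C.IsWhite (C.white i) := (C.white i).2

theorem vertex_white_ne (i : I) (k : Fin r) : C.vertex (C.white i) ≠ C.black k :=
  fun h => C.isWhite_white i (C.isBlack_of_eq h)

theorem exists_white_or_black (h : C.HalfEdge) :
    (∃ i, h = C.white i) ∨ ∃ k, C.vertex h = C.black k := by
  by_cases hw : C.IsWhite h
  · exact Or.inl ⟨C.white.symm ⟨h, hw⟩, by simp⟩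
  · exact Or.inr ⟨C.black.symm ⟨_, not_not.1 hw⟩, by simp⟩

theorem sign_face {h : C.HalfEdge} (hb : C.IsBlack (C.vertex (C.face h))) :
    C.sign (C.face h) = C.sign h := by
  have halt := C.alternated_black _ hb
  rw [C.next_face, C.sign_opp, neg_inj] at halt
  exact halt.symm

theorem next_white (i : I) : C.next (C.white i) = C.white (C.rho i) := by
  simp only [rho, Equiv.trans_apply, Equiv.apply_symm_apply]
  rfl

theorem face_eq_white {h : C.HalfEdge} {i : I} (hi : C.opp h = C.white i) :
    C.face h = C.white (C.rho⁻¹ i) := by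
  apply C.next.injective
  simp [C.next_face, C.next_white, hi]

end BlackVertices

section LabelsOfHalfEdges

variable (C : UnitaryMap I r)

theorem labelOf_eq {h : C.HalfEdge} {i : I} {k : ℕ} (hk : (C.face⁻¹ ^ k) h = C.white i)
    (hmin : ∀ j < k, ¬ C.IsWhite ((C.face⁻¹ ^ j) h)) : C.labelOf h = i := by
  classical
  have hfind : Nat.find (C.exists_white_face_inv h) = k :=
    (Nat.find_eq_iff _).2 ⟨by rw [hk]; exact C.isWhite_white i, hmin⟩
  unfold labelOf
  rw [Equiv.symm_apply_eq]
  apply Subtype.ext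
  rw [← hk, ← hfind]

theorem labelOf_white (i : I) : C.labelOf (C.white i) = i :=
  C.labelOf_eq (k := 0) rfl fun _ h => absurd h (Nat.not_lt_zero _)

theorem labelOf_face {h : C.HalfEdge} (hb : C.IsBlack (C.vertex (C.face h))) :
    C.labelOf (C.face h) = C.labelOf h := by
  classical
  have hpow (k : ℕ) : (C.face⁻¹ ^ (k + 1)) (C.face h) = (C.face⁻¹ ^ k) h := by
    simp [pow_succ]
  refine C.labelOf_eq (k := Nat.find (C.exists_white_face_inv h) + 1) ?_ ?_
  · rw [hpow, labelOf, Equiv.apply_symm_apply]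
  · intro j hj
    cases j with
    | zero => exact not_not.2 hb
    | succ j =>
      rw [hpow]
      exact Nat.find_min (C.exists_white_face_inv h) (by omega)

/-- The first white half-edge after `h` around the face at the left of `h` has the label `j`. -/
def Reaches (h : C.HalfEdge) (j : I) : Prop :=
  ∃ k : ℕ, 0 < k ∧ (C.face ^ k) h = C.white j ∧
    ∀ l, 0 < l → l < k → ¬ C.IsWhite ((C.face ^ l) h)

variable {C}

theorem Reaches.of_face_eq {h : C.HalfEdge} {j : I} (hj : C.face h = C.white j) :
    C.Reaches h j :=
  ⟨1, one_pos, hj, fun _ h1 h2 => absurd h2 (by omega)⟩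

theorem Reaches.of_face {h : C.HalfEdge} {j : I} (hb : C.IsBlack (C.vertex (C.face h)))
    (hj : C.Reaches (C.face h) j) : C.Reaches h j := by
  obtain ⟨k, -, hkj, hmin⟩ := hj
  have hpow (k : ℕ) : (C.face ^ (k + 1)) h = (C.face ^ k) (C.face h) := by
    rw [pow_succ, Equiv.Perm.mul_apply]
  refine ⟨k + 1, Nat.succ_pos k, by rw [hpow, hkj], fun l hl hlk => ?_⟩
  obtain ⟨l, rfl⟩ := Nat.exists_eq_succ_of_ne_zero hl.ne'
  rw [Nat.succ_eq_add_one, hpow]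
  rcases Nat.eq_zero_or_pos l with rfl | hl'
  · exact not_not.2 hb
  · exact hmin l hl' (by omega)

theorem Reaches.phi_eq {i j : I} (h : C.Reaches (C.white i) j) : C.phi i = j := by
  obtain ⟨k, hk, hkj, hmin⟩ := h
  have hreturn : firstReturnFun C.face C.IsWhite (C.white i) = C.white j :=
    firstReturnFun_eq C.face C.IsWhite _ _ hk hkj hmin
  have hphi : C.phi i = C.white.symm (firstReturnFun C.face C.IsWhite (C.white i)) := rfl
  rw [hphi, hreturn, Equiv.symm_apply_apply]

end LabelsOfHalfEdges

section Strands

variable (C : UnitaryMap I r)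

open Classical in
/-- The strand of `C` that starts at the white half-edge labelled `i` and turns left at each black
vertex. Since edges increase the numbers of the black vertices, the strands can be followed past the
black vertices one at a time; `C.strand i t` is the last half-edge of the strand that comes before
the black vertices numbered `t`, `t + 1`, … -/
def strand (i : I) : ℕ → C.HalfEdge
  | 0 => C.white i
  | t + 1 => if ∃ k : Fin r, (k : ℕ) = t ∧ C.vertex (C.opp (strand i t)) = C.black k then
      C.face (strand i t) else strand i t

/-- The strand that starts at the white half-edge labelled `i` visits the black vertex `t`. -/
def Visits (t : Fin r) (i : I) : Prop :=
  C.vertex (C.opp (C.strand i t)) = C.black t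

variable {C} {i : I} {t : Fin r}

theorem strand_succ_of_visits (h : C.Visits t i) :
    C.strand i (t + 1) = C.face (C.strand i t) := by
  rw [strand, if_pos ⟨t, rfl, h⟩]

theorem strand_succ_of_not_visits (h : ¬ C.Visits t i) : C.strand i (t + 1) = C.strand i t := by
  rw [strand, if_neg]
  rintro ⟨k, hk, hv⟩
  obtain rfl := Fin.ext hk
  exact h hv

theorem vertex_strand_succ (h : C.Visits t i) : C.vertex (C.strand i (t + 1)) = C.black t := by
  rw [strand_succ_of_visits h, C.vertex_face, h]

theorem next_strand_succ (h : C.Visits t i) :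
    C.next (C.strand i (t + 1)) = C.opp (C.strand i t) := by
  rw [strand_succ_of_visits h, C.next_face]

theorem strand_succ_cases {t : ℕ} (ht : t < r) (i : I) :
    (C.Visits ⟨t, ht⟩ i ∧ C.strand i (t + 1) = C.face (C.strand i t) ∧
      C.vertex (C.strand i (t + 1)) = C.black ⟨t, ht⟩) ∨
    (¬ C.Visits ⟨t, ht⟩ i ∧ C.strand i (t + 1) = C.strand i t) := by
  by_cases h : C.Visits ⟨t, ht⟩ i
  · exact Or.inl ⟨h, strand_succ_of_visits h, vertex_strand_succ h⟩
  · exact Or.inr ⟨h, strand_succ_of_not_visits h⟩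

theorem sign_strand (hi : C.eps i = 1) {t : ℕ} (ht : t ≤ r) : C.sign (C.strand i t) = 1 := by
  induction t with
  | zero => exact hi
  | succ t ih =>
    rcases strand_succ_cases ht i with ⟨-, hface, hblack⟩ | ⟨-, hstay⟩
    · rw [hface] at hblack ⊢
      rw [C.sign_face (C.isBlack_of_eq hblack), ih (by omega)]
    · rw [hstay, ih (by omega)]

theorem labelOf_strand (i : I) {t : ℕ} (ht : t ≤ r) : C.labelOf (C.strand i t) = i := by
  induction t with
  | zero => exact C.labelOf_white i
  | succ t ih =>
    rcases strand_succ_cases ht i with ⟨-, hface, hblack⟩ | ⟨-, hstay⟩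
    · rw [hface] at hblack ⊢
      rw [C.labelOf_face (C.isBlack_of_eq hblack), ih (by omega)]
    · rw [hstay, ih (by omega)]

theorem eq_of_strand_eq {j : I} {t : ℕ} (ht : t ≤ r) (h : C.strand i t = C.strand j t) : i = j := by
  rw [← C.labelOf_strand i ht, h, labelOf_strand j ht]

theorem lt_of_vertex_strand {t : ℕ} (ht : t ≤ r) {k : Fin r}
    (h : C.vertex (C.strand i t) = C.black k) : (k : ℕ) < t := by
  induction t with
  | zero => exact absurd h (C.vertex_white_ne i k)
  | succ t ih =>
    rcases strand_succ_cases ht i with ⟨-, -, hblack⟩ | ⟨-, hstay⟩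
    · rw [C.black_injective (h.symm.trans hblack)]
      exact Nat.lt_succ_self t
    · exact (ih (by omega) (hstay ▸ h)).trans (Nat.lt_succ_self t)

theorem le_of_vertex_opp_strand (hi : C.eps i = 1) {t : ℕ} (ht : t ≤ r) {k : Fin r}
    (h : C.vertex (C.opp (C.strand i t)) = C.black k) : t ≤ (k : ℕ) := by
  induction t with
  | zero => exact Nat.zero_le _
  | succ t ih =>
    rcases strand_succ_cases ht i with ⟨-, -, hblack⟩ | ⟨hvisit, hstay⟩
    · exact C.number_lt _ _ _ (sign_strand hi ht) hblack h
    · rw [hstay] at h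
      have hkt : (k : ℕ) ≠ t := by
        rintro rfl
        exact hvisit h
      have := ih (by omega) h
      omega

theorem exists_strand_eq {t : ℕ} (ht : t ≤ r) {h : C.HalfEdge} (hs : C.sign h = 1)
    (hlt : ∀ k : Fin r, C.vertex h = C.black k → (k : ℕ) < t)
    (hle : ∀ k : Fin r, C.vertex (C.opp h) = C.black k → t ≤ (k : ℕ)) :
    ∃ i, C.eps i = 1 ∧ C.strand i t = h := by
  induction t generalizing h with
  | zero =>
    rcases C.exists_white_or_black h with ⟨i, rfl⟩ | ⟨k, hk⟩
    · exact ⟨i, hs, rfl⟩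
    · exact absurd (hlt k hk) (Nat.not_lt_zero _)
  | succ t ih =>
    by_cases hu : C.vertex h = C.black ⟨t, ht⟩
    · have hface : C.face (C.opp (C.next h)) = h :=
        C.next.injective (by rw [C.next_face, C.opp_opp])
      have hvertex : C.vertex (C.opp (C.opp (C.next h))) = C.black ⟨t, ht⟩ := by
        rw [C.opp_opp, C.vertex_next, hu]
      have hsign : C.sign (C.opp (C.next h)) = 1 := by
        rw [C.sign_opp, C.alternated_black h (C.isBlack_of_eq hu), neg_neg, hs]
      obtain ⟨i, hi, hstrand⟩ := ih (by omega) hsign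
        (fun k hk => C.number_lt _ _ _ hsign hk hvertex)
        (fun k hk => by rw [← C.black_injective (hvertex.symm.trans hk)])
      have hvisit : C.Visits ⟨t, ht⟩ i := by rw [Visits, hstrand, hvertex]
      exact ⟨i, hi, (strand_succ_of_visits hvisit).trans (by rw [hstrand, hface])⟩
    · obtain ⟨i, hi, hstrand⟩ := ih (by omega) hs
        (fun k hk => (Nat.lt_succ_iff.1 (hlt k hk)).lt_of_ne fun hkt => hu (by
          rw [hk, Fin.ext (b := ⟨t, ht⟩) hkt]))
        (fun k hk => (Nat.le_succ t).trans (hle k hk))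
      have hvisit : ¬ C.Visits ⟨t, ht⟩ i := fun hv => by
        rw [Visits, hstrand] at hv
        exact (hle _ hv).not_gt (Nat.lt_succ_self t)
      exact ⟨i, hi, (strand_succ_of_not_visits hvisit).trans hstrand⟩

theorem exists_visits_of_vertex_eq {h : C.HalfEdge} (hs : C.sign h = 1)
    (hv : C.vertex h = C.black t) : ∃ i, C.eps i = 1 ∧ C.Visits t i ∧ C.strand i (t + 1) = h := by
  obtain ⟨i, hi, rfl⟩ := exists_strand_eq t.2 hs
    (fun k hk => by rw [C.black_injective (hk.symm.trans hv)]; exact Nat.lt_succ_self t)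
    (fun k hk => C.number_lt _ _ _ hs hv hk)
  refine ⟨i, hi, ?_, rfl⟩
  by_contra hvisit
  rw [strand_succ_of_not_visits hvisit] at hv
  exact lt_irrefl _ (lt_of_vertex_strand t.2.le hv)

theorem exists_ne_visits_iff (t : Fin r) : ∃ a b : OutLabel C.eps, a ≠ b ∧
    ∀ s : OutLabel C.eps, C.Visits t s ↔ s = a ∨ s = b := by
  obtain ⟨h, hv, hs⟩ := C.exists_outgoing t
  have hb := C.isBlack_of_eq hv
  have hv' : C.vertex (C.next (C.next h)) = C.black t := by rw [C.vertex_next, C.vertex_next, hv]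
  have hs' : C.sign (C.next (C.next h)) = 1 := by
    rw [C.alternated_black _ (by rwa [C.vertex_next]), C.alternated_black _ hb, neg_neg, hs]
  obtain ⟨a, ha, hta, hha⟩ := exists_visits_of_vertex_eq hs hv
  obtain ⟨b, hb', htb, hhb⟩ := exists_visits_of_vertex_eq hs' hv'
  refine ⟨⟨a, ha⟩, ⟨b, hb'⟩, ?_, fun s => ⟨fun hts => ?_, ?_⟩⟩
  · intro hab
    obtain rfl : a = b := congrArg Subtype.val hab
    exact C.next_next_ne hb (hhb.symm.trans hha)
  · by_cases hsh : C.strand s (t + 1) = h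
    · exact Or.inl (Subtype.ext (eq_of_strand_eq t.2 (hsh.trans hha.symm)))
    · have hopposite := C.next_next_eq hb ((vertex_strand_succ hts).trans hv.symm)
        ((sign_strand s.2 t.2).trans hs.symm) hsh
      exact Or.inr (Subtype.ext (eq_of_strand_eq t.2 (hopposite.symm.trans hhb.symm)))
  · rintro (rfl | rfl)
    exacts [hta, htb]

theorem exists_opp_strand_last (s : OutLabel C.eps) :
    ∃ j : InLabel C.eps, C.opp (C.strand s r) = C.white j := by
  rcases C.exists_white_or_black (C.opp (C.strand s r)) with ⟨j, hj⟩ | ⟨k, hk⟩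
  · refine ⟨⟨j, ?_⟩, hj⟩
    change C.sign (C.white j) = -1
    rw [← hj, C.sign_opp, sign_strand s.2 le_rfl]
  · exact absurd k.2 (not_lt.2 (le_of_vertex_opp_strand s.2 le_rfl hk))

theorem exists_equiv_opp_strand_last : ∃ π : OutLabel C.eps ≃ InLabel C.eps,
    ∀ s : OutLabel C.eps, C.opp (C.strand s r) = C.white (π s) := by
  choose π hπ using exists_opp_strand_last (C := C)
  have hinj : Function.Injective π := fun s s' h => Subtype.ext <|
    eq_of_strand_eq le_rfl (C.opp.injective (by rw [hπ, hπ, h]))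
  have hsurj : Function.Surjective π := by
    intro j
    have hs : C.sign (C.opp (C.white j)) = 1 := by
      rw [C.sign_opp]
      exact neg_eq_iff_eq_neg.2 j.2
    obtain ⟨i, hi, hstrand⟩ := exists_strand_eq le_rfl hs (fun k _ => k.2) (fun k hk => by
      rw [C.opp_opp] at hk
      exact absurd hk (C.vertex_white_ne j k))
    refine ⟨⟨i, hi⟩, Subtype.ext (C.white_injective ?_)⟩
    rw [← hπ, hstrand, C.opp_opp]
  exact ⟨Equiv.ofBijective π ⟨hinj, hsurj⟩, hπ⟩

theorem Iso.visits_iff_of_map_strand {D : UnitaryMap I r} (e : Iso C D)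
    (h : e.toEquiv (C.strand i t) = D.strand i t) : D.Visits t i ↔ C.Visits t i := by
  rw [Visits, Visits, ← h, ← e.map_opp, e.map_black]

theorem Iso.map_strand {D : UnitaryMap I r} (e : Iso C D) (i : I) {t : ℕ} (ht : t ≤ r) :
    e.toEquiv (C.strand i t) = D.strand i t := by
  induction t with
  | zero => exact e.map_white i
  | succ t ih =>
    have hvisits := e.visits_iff_of_map_strand (t := ⟨t, ht⟩) (ih (by omega))
    rcases strand_succ_cases (C := C) ht i with ⟨hv, hface, -⟩ | ⟨hv, hstay⟩
    · rw [hface, e.map_face, ih (by omega)]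
      exact (strand_succ_of_visits (hvisits.2 hv)).symm
    · rw [hstay, ih (by omega)]
      exact (strand_succ_of_not_visits (mt hvisits.1 hv)).symm

end Strands

end UnitaryMap

/-- In the map `C` with signs `ε`, the black vertex `t` is visited by the two distinct strands
`τ t`, and the strand that starts at the outgoing white half-edge labelled `s` ends at the ingoing
white half-edge labelled `π s`. -/
structure HasStrandData {I : Type} {r : ℕ} {ε : I → ℤˣ} (C : UnitaryMap I r)
    (τ : Fin r → OutLabel ε × OutLabel ε) (π : OutLabel ε ≃ InLabel ε) : Prop where
  eps_eq : C.eps = ε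
  ne : ∀ t, (τ t).1 ≠ (τ t).2
  visits_iff : ∀ t (s : OutLabel ε), C.Visits t s ↔ s = (τ t).1 ∨ s = (τ t).2
  opp_strand_last : ∀ s : OutLabel ε, C.opp (C.strand s r) = C.white (π s)

theorem UnitaryMap.exists_hasStrandData {I : Type} [LinearOrder I] {r : ℕ} {ε : I → ℤˣ}
    {C : UnitaryMap I r} (hε : C.eps = ε) :
    ∃ (τ : Fin r → OutLabel ε × OutLabel ε) (π : OutLabel ε ≃ InLabel ε),
      (∀ t, (τ t).1 < (τ t).2) ∧ HasStrandData C τ π := by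
  subst hε
  have hpair (t : Fin r) : ∃ p : OutLabel C.eps × OutLabel C.eps, p.1 < p.2 ∧
      ∀ s : OutLabel C.eps, C.Visits t s ↔ s = p.1 ∨ s = p.2 := by
    obtain ⟨a, b, hab, h⟩ := exists_ne_visits_iff (C := C) t
    rcases hab.lt_or_gt with hlt | hgt
    · exact ⟨(a, b), hlt, h⟩
    · exact ⟨(b, a), hgt, fun s => (h s).trans or_comm⟩
  choose τ hτ hvisits using hpair
  obtain ⟨π, hπ⟩ := exists_equiv_opp_strand_last (C := C)
  exact ⟨τ, π, hτ, rfl, fun t => (hτ t).ne, hvisits, hπ⟩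

namespace HasStrandData

open UnitaryMap

variable {I : Type} {r : ℕ} {ε : I → ℤˣ} {C : UnitaryMap I r}
  {τ : Fin r → OutLabel ε × OutLabel ε} {π : OutLabel ε ≃ InLabel ε}

theorem of_iso (W : HasStrandData C τ π) {D : UnitaryMap I r} (e : UnitaryMap.Iso C D) :
    HasStrandData D τ π where
  eps_eq := by
    rw [← W.eps_eq]
    funext i
    change D.sign (D.white i) = C.sign (C.white i)
    rw [← e.map_white, e.map_sign]
  ne := W.ne
  visits_iff t s := (e.visits_iff_of_map_strand (e.map_strand s t.2.le)).trans (W.visits_iff t s)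
  opp_strand_last s := by
    rw [← e.map_strand s le_rfl, ← e.map_opp, W.opp_strand_last, e.map_white]

theorem unique [LinearOrder I] {τ' : Fin r → OutLabel ε × OutLabel ε}
    {π' : OutLabel ε ≃ InLabel ε} (W : HasStrandData C τ π) (W' : HasStrandData C τ' π')
    (hτ : ∀ t, (τ t).1 < (τ t).2) (hτ' : ∀ t, (τ' t).1 < (τ' t).2) : τ = τ' ∧ π = π' := by
  constructor
  · funext t
    have hfst := (W'.visits_iff t _).1 ((W.visits_iff t _).2 (Or.inl rfl))
    have hsnd := (W'.visits_iff t _).1 ((W.visits_iff t _).2 (Or.inr rfl))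
    have hlt := hτ t
    rcases hfst with hfst | hfst <;> rcases hsnd with hsnd | hsnd
    · exact absurd (hfst.trans hsnd.symm) hlt.ne
    · exact Prod.ext hfst hsnd
    · rw [hfst, hsnd] at hlt
      exact absurd hlt (hτ' t).asymm
    · exact absurd (hfst.trans hsnd.symm) hlt.ne
  · ext s
    exact C.white_injective ((W.opp_strand_last s).symm.trans (W'.opp_strand_last s))

variable (W : HasStrandData C τ π)
include W

theorem eps_out (s : OutLabel ε) : C.eps s = 1 := (congrFun W.eps_eq s).trans s.2

theorem visits_fst (t : Fin r) : C.Visits t (τ t).1 := (W.visits_iff t _).2 (Or.inl rfl)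

theorem visits_snd (t : Fin r) : C.Visits t (τ t).2 := (W.visits_iff t _).2 (Or.inr rfl)

theorem next_next_strand_succ {t : Fin r} {s s' : OutLabel ε} (hs : C.Visits t s)
    (hs' : C.Visits t s') (hne : s ≠ s') :
    C.next (C.next (C.strand s (t + 1))) = C.strand s' (t + 1) :=
  C.next_next_eq (C.isBlack_of_eq (vertex_strand_succ hs))
    ((vertex_strand_succ hs').trans (vertex_strand_succ hs).symm)
    ((sign_strand (W.eps_out s') t.2).trans (sign_strand (W.eps_out s) t.2).symm)
    fun h => hne (Subtype.ext (eq_of_strand_eq t.2 h)).symm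

theorem next_opp_strand [DecidableEq (OutLabel ε)] {t : Fin r} {s : OutLabel ε}
    (h : C.Visits t s) :
    C.next (C.opp (C.strand s t)) = C.strand (Equiv.swap (τ t).1 (τ t).2 s) (t + 1) := by
  rw [← next_strand_succ h]
  rcases (W.visits_iff t s).1 h with rfl | rfl
  · rw [Equiv.swap_apply_left, W.next_next_strand_succ h (W.visits_snd t) (W.ne t)]
  · rw [Equiv.swap_apply_right, W.next_next_strand_succ h (W.visits_fst t) (W.ne t).symm]

theorem exists_visits_of_vertex_eq {h : C.HalfEdge} {t : Fin r} (hs : C.sign h = 1)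
    (hv : C.vertex h = C.black t) :
    ∃ s : OutLabel ε, C.Visits t s ∧ C.strand s (t + 1) = h := by
  obtain ⟨i, hi, hvisit, hstrand⟩ := UnitaryMap.exists_visits_of_vertex_eq hs hv
  exact ⟨⟨i, (congrFun W.eps_eq i).symm.trans hi⟩, hvisit, hstrand⟩

theorem val_eq [LinearOrder I] (hτ : ∀ t, (τ t).1 < (τ t).2) (t : Fin r) :
    C.val t = (τ t).2 := by
  unfold UnitaryMap.val
  refine (Finset.max'_eq_iff _ _ _).2 ⟨Finset.mem_image.2 ⟨C.strand (τ t).2 (t + 1), ?_, ?_⟩, ?_⟩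
  · rw [Set.Finite.mem_toFinset]
    exact ⟨vertex_strand_succ (W.visits_snd t), sign_strand (W.eps_out _) t.2⟩
  · exact labelOf_strand _ t.2
  · intro i hi
    obtain ⟨h, hh, rfl⟩ := Finset.mem_image.1 hi
    rw [Set.Finite.mem_toFinset] at hh
    obtain ⟨s, hs, rfl⟩ := W.exists_visits_of_vertex_eq hh.2 hh.1
    rw [labelOf_strand _ t.2]
    rcases (W.visits_iff t s).1 hs with rfl | rfl
    · exact (hτ t).le
    · exact le_rfl

theorem reaches_strand (s : OutLabel ε) {t : ℕ} (ht : t ≤ r) :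
    C.Reaches (C.strand s t) (C.rho⁻¹ (π s)) := by
  induction ht using Nat.decreasingInduction with
  | self => exact .of_face_eq (C.face_eq_white (W.opp_strand_last s))
  | of_succ t ht ih =>
    rcases strand_succ_cases (C := C) ht s with ⟨-, hface, hblack⟩ | ⟨-, hstay⟩
    · rw [hface] at ih hblack
      exact ih.of_face (C.isBlack_of_eq hblack)
    · rwa [hstay] at ih

theorem phi_out (s : OutLabel ε) : C.phi s = C.rho⁻¹ (π s) :=
  (W.reaches_strand s (Nat.zero_le r)).phi_eq

theorem face_opp_strand_succ [DecidableEq (OutLabel ε)] {t : Fin r} {s : OutLabel ε}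
    (h : C.Visits t s) :
    C.face (C.opp (C.strand s (t + 1))) = C.opp (C.strand (Equiv.swap (τ t).1 (τ t).2 s) t) := by
  have hswap : C.Visits t (Equiv.swap (τ t).1 (τ t).2 s) := by
    rcases (W.visits_iff t s).1 h with rfl | rfl
    · rw [Equiv.swap_apply_left]
      exact W.visits_snd t
    · rw [Equiv.swap_apply_right]
      exact W.visits_fst t
  apply C.next.injective
  rw [C.next_face, C.opp_opp, W.next_opp_strand hswap, Equiv.swap_apply_self]

theorem reaches_opp_strand [DecidableEq (OutLabel ε)] {t : ℕ} (ht : t ≤ r) (s : OutLabel ε) :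
    C.Reaches (C.opp (C.strand s t)) (C.rho⁻¹
      (((List.ofFn fun t => Equiv.swap (τ t).1 (τ t).2).take t).prod s : OutLabel ε)) := by
  induction t generalizing s with
  | zero => exact .of_face_eq (C.face_eq_white (C.opp_opp _))
  | succ t ih =>
    rw [List.prod_take_succ _ _ (by rwa [List.length_ofFn]), List.getElem_ofFn,
      Equiv.Perm.mul_apply]
    rcases strand_succ_cases (C := C) ht s with ⟨hv, -, hblack⟩ | ⟨hv, hstay⟩
    · refine .of_face ?_ ?_
      · rw [C.vertex_face, C.opp_opp]
        exact C.isBlack_of_eq hblack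
      · rw [W.face_opp_strand_succ hv]
        exact ih (by omega) _
    · rw [W.visits_iff, not_or] at hv
      rw [hstay, Equiv.swap_apply_of_ne_of_ne hv.1 hv.2]
      exact ih (by omega) s

theorem phi_in [DecidableEq (OutLabel ε)] (s : OutLabel ε) : C.phi (π s) = C.rho⁻¹
    ((List.ofFn fun t => Equiv.swap (τ t).1 (τ t).2).prod s : OutLabel ε) := by
  have h := W.reaches_opp_strand le_rfl s
  rw [W.opp_strand_last, List.take_of_length_le (by rw [List.length_ofFn])] at h
  exact h.phi_eq

end HasStrandData

/-! ## The map with prescribed strands -/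

theorem OrientedMap.apply_eq_of_vertex_eq {α : Type*} (C : OrientedMap) {f : C.HalfEdge → α}
    (hf : ∀ h, f (C.next h) = f h) {h h' : C.HalfEdge} (hv : C.vertex h = C.vertex h') :
    f h = f h' := by
  have hcycle : C.next.SameCycle h h' :=
    Quotient.exact (s := Equiv.Perm.SameCycle.setoid C.next) hv
  obtain ⟨n, -, rfl⟩ := hcycle.exists_pow_eq'
  induction n with
  | zero => rfl
  | succ n ih =>
    rw [pow_succ', Equiv.Perm.mul_apply, hf]
    exact ih (Quotient.sound ⟨n, by simp⟩) ⟨n, by simp⟩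

namespace StrandModel

variable {I : Type} {r : ℕ} {ε : I → ℤˣ}

/-- The positions on the strands: the start of a strand, or a visit of a black vertex by the first
(`true`) or the second (`false`) of its two strands. -/
abbrev Position (ε : I → ℤˣ) (r : ℕ) : Type := OutLabel ε ⊕ Fin r × Bool

section Positions

variable (τ : Fin r → OutLabel ε × OutLabel ε)

/-- The strand that makes a given visit of a black vertex. -/
def visitor : Fin r × Bool → OutLabel ε
  | (t, true) => (τ t).1
  | (t, false) => (τ t).2

theorem exists_eq_visitor_iff {t : Fin r} {s : OutLabel ε} :
    (∃ b, s = visitor τ (t, b)) ↔ s = (τ t).1 ∨ s = (τ t).2 :=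
  Bool.exists_bool.trans or_comm

open Classical in
/-- When the strands visit only the black vertices before `t`, the permutation sending each position
to the one that precedes it on its strand, where the start of a strand is preceded by the last
position of the strand. Inserting the two visits of `t` amounts to two transpositions. -/
def previousPerm : ℕ → Equiv.Perm (Position ε r)
  | 0 => 1
  | t + 1 => if ht : t < r then
      previousPerm t * (Equiv.swap (Sum.inl (τ ⟨t, ht⟩).1) (Sum.inr (⟨t, ht⟩, true)) *
        Equiv.swap (Sum.inl (τ ⟨t, ht⟩).2) (Sum.inr (⟨t, ht⟩, false)))
    else previousPerm t

theorem previousPerm_inr_of_le {t : ℕ} {v : Fin r × Bool} (ht : t ≤ v.1) :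
    previousPerm τ t (Sum.inr v) = Sum.inr v := by
  induction t with
  | zero => rfl
  | succ t ih =>
    have hne (b : Bool) : v ≠ (⟨t, by omega⟩, b) := fun hv =>
      ht.not_gt ((congrArg (fun w => (w.1 : ℕ)) hv).trans_lt (Nat.lt_succ_self t))
    simp [previousPerm, (show t < r by omega), Equiv.swap_apply_of_ne_of_ne, hne,
      ih (by omega)]

theorem previousPerm_succ_inr_of_ne {t : ℕ} {v : Fin r × Bool} (ht : (v.1 : ℕ) ≠ t) :
    previousPerm τ (t + 1) (Sum.inr v) = previousPerm τ t (Sum.inr v) := by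
  have hne (h : t < r) (b : Bool) : v ≠ (⟨t, h⟩, b) := by
    rintro rfl
    exact ht rfl
  by_cases h : t < r <;> simp [previousPerm, h, Equiv.swap_apply_of_ne_of_ne, hne]

theorem previousPerm_succ_inl_of_ne {t : Fin r} {s : OutLabel ε} (h : ∀ b, s ≠ visitor τ (t, b)) :
    previousPerm τ (t + 1) (Sum.inl s) = previousPerm τ t (Sum.inl s) := by
  have hfst : s ≠ (τ t).1 := h true
  have hsnd : s ≠ (τ t).2 := h false
  simp [previousPerm, Equiv.swap_apply_of_ne_of_ne, hfst, hsnd]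

variable {τ} (hτ : ∀ t, (τ t).1 ≠ (τ t).2)
include hτ

theorem previousPerm_succ_visitor (t : Fin r) (b : Bool) :
    previousPerm τ (t + 1) (Sum.inl (visitor τ (t, b))) = Sum.inr (t, b) := by
  cases b <;>
    simp [previousPerm, visitor, Equiv.swap_apply_of_ne_of_ne, hτ, previousPerm_inr_of_le]

theorem previousPerm_succ_inr (t : Fin r) (b : Bool) :
    previousPerm τ (t + 1) (Sum.inr (t, b)) = previousPerm τ t (Sum.inl (visitor τ (t, b))) := by
  cases b <;> simp [previousPerm, visitor, Equiv.swap_apply_of_ne_of_ne, (hτ t).symm]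

theorem previousPerm_inr (t : Fin r) (b : Bool) :
    previousPerm τ r (Sum.inr (t, b)) = previousPerm τ t (Sum.inl (visitor τ (t, b))) := by
  rw [← previousPerm_succ_inr hτ]
  have hstable : ∀ n ≥ (t + 1 : ℕ),
      previousPerm τ n (Sum.inr (t, b)) = previousPerm τ (t + 1) (Sum.inr (t, b)) :=
    Nat.le_induction rfl fun n hn ih => by
      rw [previousPerm_succ_inr_of_ne τ (Nat.ne_of_lt hn), ih]
  exact hstable r t.2

end Positions

/-- The half-edges of the model: the white ones, and the outgoing and ingoing ones at each visit of
a black vertex. -/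
abbrev Dart (I : Type) (r : ℕ) : Type := I ⊕ (Fin r × Bool ⊕ Fin r × Bool)

/-- The outgoing half-edge that follows a position on its strand. -/
def outDart : Position ε r → Dart I r :=
  Sum.map Subtype.val Sum.inl

/-- The ingoing half-edge that precedes a position on its strand, the end of the strand `s` being
the white half-edge labelled `π s` and preceding the start of `s`. -/
def inDart (π : OutLabel ε ≃ InLabel ε) : Position ε r → Dart I r :=
  Sum.map (fun s => (π s : I)) Sum.inr

/-- The sign of a half-edge of the model. -/
def dartSign (ε : I → ℤˣ) : Dart I r → ℤˣ :=
  Sum.elim ε (Sum.elim (fun _ => 1) fun _ => -1)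

/-- The number of the black vertex of a half-edge of the model, `none` for a white half-edge. -/
def dartVertex : Dart I r → Option (Fin r) :=
  Sum.elim (fun _ => none) (Sum.elim (fun v => some v.1) fun v => some v.1)

/-- The successor of a half-edge of the model around its vertex. -/
def dartNext (ρ : Equiv.Perm I) : Equiv.Perm (Dart I r) :=
  Equiv.sumCongr ρ
    ((Equiv.sumCongr (Equiv.refl _) (Equiv.prodCongrRight fun _ => Equiv.boolNot)).trans
      (Equiv.sumComm _ _))

/-- Each half-edge of the model follows or precedes exactly one position. -/
def dartEquiv (π : OutLabel ε ≃ InLabel ε) : Position ε r ⊕ Position ε r ≃ Dart I r :=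
  (Equiv.sumSumSumComm _ _ _ _).trans
    (Equiv.sumCongr ((Equiv.sumCongr (Equiv.refl _) π).trans (labelEquiv ε)) (Equiv.refl _))

theorem dartEquiv_inl (π : OutLabel ε ≃ InLabel ε) (x : Position ε r) :
    dartEquiv π (Sum.inl x) = outDart x := by
  cases x <;> rfl

theorem dartEquiv_inr (π : OutLabel ε ≃ InLabel ε) (x : Position ε r) :
    dartEquiv π (Sum.inr x) = inDart π x := by
  cases x <;> rfl

theorem dartSign_outDart (x : Position ε r) : dartSign ε (outDart x) = 1 := by
  rcases x with s | v
  exacts [s.2, rfl]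

theorem dartSign_inDart (π : OutLabel ε ≃ InLabel ε) (x : Position ε r) :
    dartSign ε (inDart π x) = -1 := by
  rcases x with s | v
  exacts [(π s).2, rfl]

theorem dartVertex_dartNext (ρ : Equiv.Perm I) (h : Dart I r) :
    dartVertex (dartNext ρ h) = dartVertex h := by
  rcases h with i | v | v <;> rfl

theorem dartVertex_eq_some_iff {h : Dart I r} {t : Fin r} : dartVertex h = some t ↔
    (∃ b, h = Sum.inr (Sum.inl (t, b))) ∨ ∃ b, h = Sum.inr (Sum.inr (t, b)) := by
  rcases h with i | ⟨u, b⟩ | ⟨u, b⟩ <;> simp [dartVertex]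

section Opposite

variable (τ : Fin r → OutLabel ε × OutLabel ε) (π : OutLabel ε ≃ InLabel ε)

/-- The exchange of the half-edges of an edge of the model: an edge joins a position to the next one
on its strand. -/
def dartOpp : Equiv.Perm (Dart I r) :=
  (dartEquiv π).permCongr
    ((Equiv.sumCongr (previousPerm τ r).symm (previousPerm τ r)).trans (Equiv.sumComm _ _))

theorem dartOpp_inDart (x : Position ε r) :
    dartOpp τ π (inDart π x) = outDart (previousPerm τ r x) := by
  simp [dartOpp, ← dartEquiv_inl π, ← dartEquiv_inr]

theorem dartOpp_outDart (x : Position ε r) :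
    dartOpp τ π (outDart (previousPerm τ r x)) = inDart π x := by
  simp [dartOpp, ← dartEquiv_inl π, ← dartEquiv_inr]

theorem exists_eq_outDart_or_inDart (h : Dart I r) :
    ∃ x, h = outDart (previousPerm τ r x) ∨ h = inDart π x := by
  obtain ⟨y | x, rfl⟩ := (dartEquiv π).surjective h
  · obtain ⟨x, rfl⟩ := (previousPerm τ r).surjective y
    exact ⟨x, Or.inl (dartEquiv_inl π _)⟩
  · exact ⟨x, Or.inr (dartEquiv_inr π x)⟩

theorem dartOpp_dartOpp (h : Dart I r) : dartOpp τ π (dartOpp τ π h) = h := by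
  obtain ⟨x, rfl | rfl⟩ := exists_eq_outDart_or_inDart τ π h
  · rw [dartOpp_outDart, dartOpp_inDart]
  · rw [dartOpp_inDart, dartOpp_outDart]

theorem dartSign_dartOpp (h : Dart I r) : dartSign ε (dartOpp τ π h) = -dartSign ε h := by
  obtain ⟨x, rfl | rfl⟩ := exists_eq_outDart_or_inDart τ π h
  · rw [dartOpp_outDart, dartSign_outDart, dartSign_inDart]
  · rw [dartOpp_inDart, dartSign_outDart, dartSign_inDart, neg_neg]

variable {τ} in
theorem lt_of_dartVertex_eq (hτ : ∀ t, (τ t).1 ≠ (τ t).2) {h : Dart I r} {k l : Fin r}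
    (hs : dartSign ε h = 1) (hk : dartVertex h = some k)
    (hl : dartVertex (dartOpp τ π h) = some l) : k < l := by
  obtain ⟨x, rfl | rfl⟩ := exists_eq_outDart_or_inDart τ π h
  · rw [dartOpp_outDart] at hl
    rcases x with s | ⟨u, b⟩
    · exact absurd hl (by simp [dartVertex, inDart])
    · obtain rfl : u = l := Option.some.inj hl
      rw [previousPerm_inr hτ] at hk
      rcases hx : previousPerm τ u (Sum.inl (visitor τ (u, b))) with s | v
      · rw [hx] at hk
        exact absurd hk (by simp [dartVertex, outDart])
      · obtain rfl : v.1 = k := by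
          rw [hx] at hk
          exact Option.some.inj hk
        by_contra hle
        rw [← previousPerm_inr_of_le τ (v := v) (not_lt.1 hle)] at hx
        exact Sum.inl_ne_inr ((previousPerm τ u).injective hx)
  · rw [dartSign_inDart] at hs
    exact absurd hs (by decide)

end Opposite

variable [Finite I] (τ : Fin r → OutLabel ε × OutLabel ε) (π : OutLabel ε ≃ InLabel ε)
  (ρ : Equiv.Perm I)

/-- The oriented map underlying the model. -/
def orientedMap : OrientedMap where
  HalfEdge := Dart I r
  finite := inferInstance
  next := dartNext ρ
  opp := dartOpp τ π
  opp_opp := dartOpp_dartOpp τ π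
  opp_ne h hopp := by
    have hsign := dartSign_dartOpp τ π h
    rw [hopp] at hsign
    exact absurd hsign.symm ((by decide : ∀ u : ℤˣ, -u ≠ u) _)
  sign := dartSign ε
  sign_opp := dartSign_dartOpp τ π

/-- The black vertex number `t` of the model. -/
def blackVertex (t : Fin r) : (orientedMap τ π ρ).Vertex :=
  (orientedMap τ π ρ).vertex (Sum.inr (Sum.inl (t, true)) : Dart I r)

theorem vertex_eq_blackVertex_iff {h : Dart I r} {t : Fin r} :
    (orientedMap τ π ρ).vertex h = blackVertex τ π ρ t ↔ dartVertex h = some t := by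
  constructor
  · exact (orientedMap τ π ρ).apply_eq_of_vertex_eq (dartVertex_dartNext ρ)
  · have hin (b : Bool) : (orientedMap τ π ρ).vertex (Sum.inr (Sum.inr (t, b)) : Dart I r) =
        (orientedMap τ π ρ).vertex (Sum.inr (Sum.inl (t, b)) : Dart I r) :=
      (orientedMap τ π ρ).vertex_next (Sum.inr (Sum.inl (t, b)) : Dart I r)
    have hout : (orientedMap τ π ρ).vertex (Sum.inr (Sum.inl (t, false)) : Dart I r) =
        blackVertex τ π ρ t :=
      ((orientedMap τ π ρ).vertex_next (Sum.inr (Sum.inr (t, true)) : Dart I r)).trans (hin true)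
    rw [dartVertex_eq_some_iff]
    rintro (⟨_ | _, rfl⟩ | ⟨_ | _, rfl⟩)
    exacts [hout, rfl, (hin false).trans hout, hin true]

theorem card_blackVertex (t : Fin r) :
    Nat.card {h // (orientedMap τ π ρ).vertex h = blackVertex τ π ρ t} = 4 := by
  let f (v : Bool ⊕ Bool) : Dart I r := Sum.inr (Sum.map (Prod.mk t) (Prod.mk t) v)
  have hf (v : Bool ⊕ Bool) : (orientedMap τ π ρ).vertex (f v) = blackVertex τ π ρ t :=
    (vertex_eq_blackVertex_iff τ π ρ).2 (by rcases v with b | b <;> rfl)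
  refine (Nat.card_eq_of_bijective (fun v => ⟨f v, hf v⟩) ⟨fun v v' h => ?_, ?_⟩).symm.trans
    (by simp)
  · exact Sum.map_injective.2 ⟨Prod.mk_right_injective t, Prod.mk_right_injective t⟩
      (Sum.inr_injective (congrArg Subtype.val h))
  · rintro ⟨h, hh⟩
    rcases dartVertex_eq_some_iff.1 ((vertex_eq_blackVertex_iff τ π ρ).1 hh) with
      ⟨b, rfl⟩ | ⟨b, rfl⟩
    exacts [⟨Sum.inl b, rfl⟩, ⟨Sum.inr b, rfl⟩]

variable {τ} (hτ : ∀ t, (τ t).1 ≠ (τ t).2)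

/-- The map in which the strands `(τ t).1` and `(τ t).2` cross at the black vertex number `t` and
the strand `s` ends at the white half-edge labelled `π s`. -/
def toMap : UnitaryMap I r where
  toOrientedMap := orientedMap τ π ρ
  IsBlack v := ∃ t, blackVertex τ π ρ t = v
  black := Equiv.ofInjective _ fun t _ h => Option.some.inj <|
    ((vertex_eq_blackVertex_iff τ π ρ).1 h.symm).symm
  degree_black := by
    rintro _ ⟨t, rfl⟩
    exact card_blackVertex τ π ρ t
  alternated_black := by
    rintro h ⟨t, ht⟩
    rcases dartVertex_eq_some_iff.1 ((vertex_eq_blackVertex_iff τ π ρ).1 ht.symm) with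
      ⟨b, rfl⟩ | ⟨b, rfl⟩
    exacts [rfl, rfl]
  white := Equiv.ofBijective
    (fun i => ⟨(Sum.inl i : Dart I r), fun ⟨t, ht⟩ => Option.some_ne_none t
      ((vertex_eq_blackVertex_iff τ π ρ).1 ht.symm).symm⟩)
    ⟨fun _ _ h => Sum.inl_injective (congrArg Subtype.val h), by
      rintro ⟨i | v | v, hv⟩
      · exact ⟨i, rfl⟩
      · exact absurd ⟨v.1, ((vertex_eq_blackVertex_iff τ π ρ).2 rfl).symm⟩ hv
      · exact absurd ⟨v.1, ((vertex_eq_blackVertex_iff τ π ρ).2 rfl).symm⟩ hv⟩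
  number_lt _ _ _ hs hk hl := lt_of_dartVertex_eq π hτ hs
    ((vertex_eq_blackVertex_iff τ π ρ).1 hk) ((vertex_eq_blackVertex_iff τ π ρ).1 hl)

theorem toMap_vertex_eq_iff {h : Dart I r} {t : Fin r} :
    (toMap π ρ hτ).vertex h = (toMap π ρ hτ).black t ↔ dartVertex h = some t :=
  vertex_eq_blackVertex_iff τ π ρ

theorem toMap_isWhite_iff {h : Dart I r} :
    (toMap π ρ hτ).IsWhite h ↔ ∀ t, dartVertex h ≠ some t :=
  not_exists.trans (forall_congr' fun _ =>
    not_congr (eq_comm.trans (vertex_eq_blackVertex_iff τ π ρ)))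

theorem toMap_eps : (toMap π ρ hτ).eps = ε := rfl

theorem toMap_rho : (toMap π ρ hτ).rho = ρ := by
  ext i
  exact (toMap π ρ hτ).white_injective ((toMap π ρ hτ).next_white i).symm

theorem toMap_visits_iff_of_strand_eq {t : Fin r} {s : OutLabel ε}
    (hs : (toMap π ρ hτ).strand s t = outDart (previousPerm τ t (Sum.inl s))) :
    (toMap π ρ hτ).Visits t s ↔ ∃ b, s = visitor τ (t, b) := by
  rw [UnitaryMap.Visits, hs]
  refine (toMap_vertex_eq_iff π ρ hτ).trans ?_
  change dartVertex (dartOpp τ π _) = _ ↔ _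
  constructor
  · obtain ⟨x, hx⟩ := (previousPerm τ r).surjective (previousPerm τ t (Sum.inl s))
    rw [← hx, dartOpp_outDart]
    intro hv
    rcases x with s' | ⟨u, b⟩
    · exact absurd hv (by simp [dartVertex, inDart])
    · obtain rfl : u = t := Option.some.inj hv
      rw [previousPerm_inr hτ] at hx
      exact ⟨b, (Sum.inl_injective ((previousPerm τ u).injective hx)).symm⟩
  · rintro ⟨b, rfl⟩
    rw [← previousPerm_inr hτ, dartOpp_outDart]
    rfl

theorem toMap_strand (s : OutLabel ε) {t : ℕ} (ht : t ≤ r) :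
    (toMap π ρ hτ).strand s t = outDart (previousPerm τ t (Sum.inl s)) := by
  induction t with
  | zero => rfl
  | succ t ih =>
    have hs := ih (by omega)
    have hvisits := toMap_visits_iff_of_strand_eq (t := ⟨t, ht⟩) π ρ hτ hs
    by_cases hv : (toMap π ρ hτ).Visits ⟨t, ht⟩ s
    · obtain ⟨b, rfl⟩ := hvisits.1 hv
      apply (toMap π ρ hτ).next.injective
      rw [UnitaryMap.next_strand_succ hv, hs, previousPerm_succ_visitor hτ ⟨t, ht⟩ b,
        ← previousPerm_inr hτ ⟨t, ht⟩ b]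
      exact dartOpp_outDart τ π _
    · rw [UnitaryMap.strand_succ_of_not_visits hv,
        previousPerm_succ_inl_of_ne τ (t := ⟨t, ht⟩) fun b hb => hv (hvisits.2 ⟨b, hb⟩)]
      exact hs

theorem hasStrandData_toMap : HasStrandData (toMap π ρ hτ) τ π where
  eps_eq := toMap_eps π ρ hτ
  ne := hτ
  visits_iff t s := (toMap_visits_iff_of_strand_eq π ρ hτ (toMap_strand π ρ hτ s t.2.le)).trans
    (exists_eq_visitor_iff τ)
  opp_strand_last s := by
    rw [toMap_strand π ρ hτ s le_rfl]
    exact dartOpp_outDart τ π (Sum.inl s)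

end StrandModel

namespace HasStrandData

open UnitaryMap StrandModel

variable {I : Type} {r : ℕ} {ε : I → ℤˣ} {C : UnitaryMap I r}
  {τ : Fin r → OutLabel ε × OutLabel ε} {π : OutLabel ε ≃ InLabel ε}

variable (C τ) in
/-- The half-edge of `C` that corresponds to a half-edge of the model. -/
def ofDart : Dart I r → C.HalfEdge :=
  Sum.elim (fun i => C.white i) (Sum.elim (fun v => C.strand (visitor τ v) (v.1 + 1))
    fun v => C.opp (C.strand (visitor τ v) v.1))

variable (W : HasStrandData C τ π)
include W

theorem visits_visitor (v : Fin r × Bool) : C.Visits v.1 (visitor τ v) :=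
  (W.visits_iff _ _).2 ((exists_eq_visitor_iff τ).1 ⟨v.2, rfl⟩)

theorem visitor_not_ne (t : Fin r) (b : Bool) : visitor τ (t, b) ≠ visitor τ (t, !b) := by
  cases b
  exacts [(W.ne t).symm, W.ne t]

theorem next_opp_strand_visitor (t : Fin r) (b : Bool) :
    C.next (C.opp (C.strand (visitor τ (t, b)) t)) = C.strand (visitor τ (t, !b)) (t + 1) := by
  rw [← next_strand_succ (W.visits_visitor (t, b))]
  exact W.next_next_strand_succ (W.visits_visitor (t, b)) (W.visits_visitor (t, !b))
    (W.visitor_not_ne t b)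

theorem sign_ofDart (h : Dart I r) : C.sign (ofDart C τ h) = dartSign ε h := by
  rcases h with i | v | v
  · exact congrFun W.eps_eq i
  · exact sign_strand (W.eps_out _) v.1.2
  · exact (C.sign_opp _).trans (congrArg Neg.neg (sign_strand (W.eps_out _) v.1.2.le))

theorem vertex_ofDart_eq_iff {h : Dart I r} {t : Fin r} :
    C.vertex (ofDart C τ h) = C.black t ↔ dartVertex h = some t := by
  have hblack {h' : C.HalfEdge} {u : Fin r} (hu : C.vertex h' = C.black u) :
      C.vertex h' = C.black t ↔ some u = some t := by
    rw [hu, Option.some_inj]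
    exact ⟨C.black_injective, fun h => h ▸ rfl⟩
  rcases h with i | v | v
  · exact iff_of_false (C.vertex_white_ne i t) (Option.some_ne_none t).symm
  · exact hblack (vertex_strand_succ (W.visits_visitor v))
  · exact hblack (W.visits_visitor v)

theorem ofDart_injective : Function.Injective (ofDart C τ) := by
  have hvisitor {t : Fin r} {b b' : Bool} (h : visitor τ (t, b) = visitor τ (t, b')) : b = b' := by
    by_contra hne
    exact W.visitor_not_ne t b (h.trans (by rw [Bool.not_eq.2 hne]))
  intro h h' heq
  have hvertex : dartVertex h = dartVertex h' := Option.ext fun t => by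
    rw [← W.vertex_ofDart_eq_iff, heq, W.vertex_ofDart_eq_iff]
  have hsign : dartSign ε h = dartSign ε h' := by rw [← W.sign_ofDart, heq, W.sign_ofDart]
  rcases h with i | ⟨t, b⟩ | ⟨t, b⟩ <;> rcases h' with j | ⟨t', b'⟩ | ⟨t', b'⟩
  · exact congrArg Sum.inl (C.white_injective heq)
  · cases hvertex
  · cases hvertex
  · cases hvertex
  · obtain rfl : t = t' := Option.some.inj hvertex
    rw [hvisitor (Subtype.ext (eq_of_strand_eq t.2 heq))]
  · exact absurd hsign (show (1 : ℤˣ) ≠ -1 by decide)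
  · cases hvertex
  · exact absurd hsign (show (-1 : ℤˣ) ≠ 1 by decide)
  · obtain rfl : t = t' := Option.some.inj hvertex
    rw [hvisitor (Subtype.ext (eq_of_strand_eq t.2.le (C.opp.injective heq)))]

theorem ofDart_surjective : Function.Surjective (ofDart C τ) := by
  intro h
  rcases C.exists_white_or_black h with ⟨i, rfl⟩ | ⟨t, ht⟩
  · exact ⟨Sum.inl i, rfl⟩
  rcases Int.units_eq_one_or (C.sign h) with hs | hs
  · obtain ⟨s, hv, rfl⟩ := W.exists_visits_of_vertex_eq hs ht
    obtain ⟨b, rfl⟩ := (exists_eq_visitor_iff τ).2 ((W.visits_iff t s).1 hv)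
    exact ⟨Sum.inr (Sum.inl (t, b)), rfl⟩
  · have hs' : C.sign (C.next h) = 1 := by
      rw [C.alternated_black h (C.isBlack_of_eq ht), hs, neg_neg]
    obtain ⟨s, hv, hh⟩ := W.exists_visits_of_vertex_eq hs' ((C.vertex_next h).trans ht)
    obtain ⟨b, rfl⟩ := (exists_eq_visitor_iff τ).2 ((W.visits_iff t s).1 hv)
    refine ⟨Sum.inr (Sum.inr (t, !b)), C.next.injective (Eq.trans ?_ hh)⟩
    exact (W.next_opp_strand_visitor t !b).trans (by rw [Bool.not_not])

theorem ofDart_dartNext (h : Dart I r) :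
    ofDart C τ (dartNext C.rho h) = C.next (ofDart C τ h) := by
  rcases h with i | v | ⟨t, b⟩
  · exact (C.next_white i).symm
  · exact (next_strand_succ (W.visits_visitor v)).symm
  · exact (W.next_opp_strand_visitor t b).symm

theorem ofDart_outDart_previousPerm (s : OutLabel ε) {t : ℕ} (ht : t ≤ r) :
    ofDart C τ (outDart (previousPerm τ t (Sum.inl s))) = C.strand s t := by
  induction t with
  | zero => rfl
  | succ t ih =>
    by_cases hv : C.Visits ⟨t, ht⟩ s
    · obtain ⟨b, rfl⟩ := (exists_eq_visitor_iff τ).2 ((W.visits_iff _ s).1 hv)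
      rw [previousPerm_succ_visitor W.ne ⟨t, ht⟩ b]
      rfl
    · have hne (b : Bool) : s ≠ visitor τ (⟨t, ht⟩, b) := fun hb =>
        hv ((W.visits_iff _ s).2 ((exists_eq_visitor_iff τ).1 ⟨b, hb⟩))
      rw [strand_succ_of_not_visits hv, previousPerm_succ_inl_of_ne τ (t := ⟨t, ht⟩) hne]
      exact ih (by omega)

theorem opp_ofDart_inDart (x : Position ε r) :
    C.opp (ofDart C τ (inDart π x)) = ofDart C τ (outDart (previousPerm τ r x)) := by
  rcases x with s | ⟨t, b⟩
  · rw [W.ofDart_outDart_previousPerm s le_rfl, ← C.opp_opp (C.strand s r), W.opp_strand_last]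
    rfl
  · rw [previousPerm_inr W.ne, W.ofDart_outDart_previousPerm _ t.2.le]
    exact C.opp_opp _

theorem ofDart_dartOpp (h : Dart I r) : ofDart C τ (dartOpp τ π h) = C.opp (ofDart C τ h) := by
  obtain ⟨x, rfl | rfl⟩ := exists_eq_outDart_or_inDart τ π h
  · rw [dartOpp_outDart, ← W.opp_ofDart_inDart, C.opp_opp]
  · rw [dartOpp_inDart, W.opp_ofDart_inDart]

theorem isWhite_ofDart_iff {h : Dart I r} :
    C.IsWhite (ofDart C τ h) ↔ ∀ t, dartVertex h ≠ some t := by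
  rw [← forall_congr' fun t => not_congr (W.vertex_ofDart_eq_iff (h := h) (t := t))]
  rcases C.exists_white_or_black (ofDart C τ h) with ⟨i, hi⟩ | ⟨t, ht⟩
  · rw [hi]
    exact iff_of_true (C.isWhite_white i) (C.vertex_white_ne i)
  · exact iff_of_false (not_not.2 (C.isBlack_of_eq ht)) fun hne => hne t ht

/-- A map with given strand data is isomorphic to the model. -/
def isoToMap [Finite I] : Iso (toMap π C.rho W.ne) C where
  toEquiv := Equiv.ofBijective (ofDart C τ) ⟨W.ofDart_injective, W.ofDart_surjective⟩
  map_next := W.ofDart_dartNext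
  map_opp := W.ofDart_dartOpp
  map_sign := W.sign_ofDart
  map_isWhite _ := W.isWhite_ofDart_iff.trans (toMap_isWhite_iff π C.rho W.ne).symm
  map_black _ _ := W.vertex_ofDart_eq_iff.trans (toMap_vertex_eq_iff π C.rho W.ne).symm
  map_white _ := rfl

end HasStrandData

/-! ## Sums over maps -/

section MapSums

variable {I : Type} [LinearOrder I] {N r : ℕ} {ε : I → ℤˣ}

section MapOfData

variable [Finite I] (ρ : Equiv.Perm I)

/-- The class of the nondecreasing map whose black vertices are visited by the successive pairs of
strands of a monotone walk, and whose strands end as prescribed by a matching. -/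
def mapOfData (d : MonotoneWalk (OutLabel ε) r × (OutLabel ε ≃ InLabel ε)) : MapClass I r ε ρ :=
  Quotient.mk (NondecreasingMap.setoid I r ε ρ)
    ⟨StrandModel.toMap d.2 ρ fun t => (d.1.lt t).ne, by
      have W := StrandModel.hasStrandData_toMap d.2 ρ fun t => (d.1.lt t).ne
      intro k l hkl
      rw [W.val_eq d.1.lt, W.val_eq d.1.lt]
      exact d.1.mono hkl,
      StrandModel.toMap_eps _ _ _, StrandModel.toMap_rho _ _ _⟩

theorem mapOfData_injective : Function.Injective (mapOfData (r := r) (ε := ε) ρ) := by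
  intro d d' h
  obtain ⟨e⟩ : Nonempty (UnitaryMap.Iso (StrandModel.toMap d.2 ρ fun t => (d.1.lt t).ne)
      (StrandModel.toMap d'.2 ρ fun t => (d'.1.lt t).ne)) := Quotient.exact h
  have W := StrandModel.hasStrandData_toMap d.2 ρ fun t => (d.1.lt t).ne
  have W' := StrandModel.hasStrandData_toMap d'.2 ρ fun t => (d'.1.lt t).ne
  obtain ⟨hseq, hmatching⟩ := (W.of_iso e).unique W' d.1.lt d'.1.lt
  exact Prod.ext (MonotoneWalk.ext hseq) hmatching

theorem mapOfData_surjective : Function.Surjective (mapOfData (r := r) (ε := ε) ρ) := by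
  intro c
  obtain ⟨⟨C, hC, hε, rfl⟩, rfl⟩ := Quotient.exists_rep c
  obtain ⟨τ, π, hτ, W⟩ := UnitaryMap.exists_hasStrandData hε
  have hmono : Monotone fun t => (τ t).2 := fun k l hkl => by
    simpa only [W.val_eq hτ, Subtype.coe_le_coe] using hC hkl
  exact ⟨(⟨τ, hτ, hmono⟩, π), Quotient.sound ⟨W.isoToMap⟩⟩

instance : Finite (MapClass I r ε ρ) :=
  Finite.of_surjective _ (mapOfData_surjective ρ)

variable (d : MonotoneWalk (OutLabel ε) r × (OutLabel ε ≃ InLabel ε)) (s : OutLabel ε)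

theorem phi_mapOfData_out : (mapOfData ρ d).phi s = ρ⁻¹ (d.2 s) := by
  have h := (StrandModel.hasStrandData_toMap d.2 ρ fun t => (d.1.lt t).ne).phi_out s
  rwa [StrandModel.toMap_rho] at h

theorem phi_mapOfData_in : (mapOfData ρ d).phi (d.2 s) = ρ⁻¹ (d.1.perm s : OutLabel ε) := by
  have h := (StrandModel.hasStrandData_toMap d.2 ρ fun t => (d.1.lt t).ne).phi_in s
  rwa [StrandModel.toMap_rho] at h

theorem eq_comp_phi_mapOfData_iff {α : Type*} (x y : I → α) :
    y = x ∘ (mapOfData ρ d).phi ↔ ∀ s : OutLabel ε,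
      x (ρ⁻¹ (d.2 s)) = y s ∧ y (d.2 s) = x (ρ⁻¹ (d.1.perm s : OutLabel ε)) := by
  rw [funext_iff, ← (labelEquiv ε).forall_congr_right, Sum.forall,
    ← d.2.forall_congr_right (q := fun s => y (labelEquiv ε (Sum.inr s)) = _), ← forall_and]
  refine forall_congr' fun s => and_congr (eq_comm.trans ?_) ?_
  · change x ((mapOfData ρ d).phi s) = y s ↔ _
    rw [phi_mapOfData_out]
  · change y (d.2 s) = x ((mapOfData ρ d).phi (d.2 s)) ↔ _
    rw [phi_mapOfData_in]

end MapOfData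

variable [Fintype I]

theorem card_filter_eq_comp_phi (γ : Equiv.Perm I) [Fintype (MapClass I r ε γ⁻¹)]
    (x y : I → Fin N) :
    (Finset.univ.filter fun C : MapClass I r ε γ⁻¹ => y = x ∘ C.phi).card =
      monotoneCount r (fun s : OutLabel ε => y s) (fun s : OutLabel ε => x (γ s))
        (fun s : InLabel ε => x (γ s)) (fun s : InLabel ε => y s) := by
  have hbij : Function.Bijective (mapOfData (r := r) (ε := ε) γ⁻¹) :=
    ⟨mapOfData_injective _, mapOfData_surjective _⟩
  simp only [monotoneCount, matchCount, Finset.card_filter]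
  rw [← hbij.sum_comp, Fintype.sum_prod_type]
  refine Finset.sum_congr rfl fun τ _ => ?_
  rw [← (τ.perm.symm.equivCongr (Equiv.refl (InLabel ε))).sum_comp]
  refine Finset.sum_congr rfl fun π _ => if_congr ?_ rfl rfl
  rw [eq_comp_phi_mapOfData_iff, ← (τ.perm⁻¹).forall_congr_right (q := fun s => _ ∧ _)]
  simp

theorem permTrace_eq_sum_sum (σ : Equiv.Perm I) (M : I → Matrix (Fin N) (Fin N) ℂ) :
    permTrace σ M = ∑ x : I → Fin N, ∑ y : I → Fin N,
      (∏ k, M k (x k) (y k)) * if y = x ∘ σ then 1 else 0 := by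
  simp only [permTrace_eq_sum, mul_ite, mul_one, mul_zero, Finset.sum_ite_eq', Finset.mem_univ,
    if_true, Function.comp_apply]

theorem finsum_permTrace_phi (γ : Equiv.Perm I) (M : I → Matrix (Fin N) (Fin N) ℂ) :
    ∑ᶠ C : MapClass I r ε γ⁻¹, permTrace C.phi M = ∑ x : I → Fin N, ∑ y : I → Fin N,
      (∏ k, M k (x k) (y k)) * monotoneCount r (fun s : OutLabel ε => y s)
        (fun s : OutLabel ε => x (γ s)) (fun s : InLabel ε => x (γ s))
        (fun s : InLabel ε => y s) := by
  let _ : Fintype (MapClass I r ε γ⁻¹) := Fintype.ofFinite _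
  simp only [finsum_eq_sum_of_fintype, permTrace_eq_sum_sum]
  rw [Finset.sum_comm]
  refine Finset.sum_congr rfl fun x _ => ?_
  rw [Finset.sum_comm]
  refine Finset.sum_congr rfl fun y _ => ?_
  rw [← Finset.mul_sum, Finset.sum_boole, card_filter_eq_comp_phi]

end MapSums

section HaarMoments

variable {I : Type} [Fintype I] {N : ℕ} (ε : I → ℤˣ)

theorem prod_coe_zpow_apply (U : Matrix.unitaryGroup (Fin N) ℂ) (i j : I → Fin N) :
    ∏ k, ((U ^ (ε k : ℤ) : Matrix.unitaryGroup (Fin N) ℂ) : Matrix (Fin N) (Fin N) ℂ)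
        (i k) (j k) =
      entryProd (fun s : OutLabel ε => i s) (fun s : OutLabel ε => j s)
        (fun s : InLabel ε => j s) (fun s : InLabel ε => i s) (U : Matrix (Fin N) (Fin N) ℂ) := by
  rw [← (labelEquiv ε).prod_comp, Fintype.prod_sum_type, entryProd]
  congr 1
  · refine Finset.prod_congr rfl fun s _ => ?_
    change ((U ^ (ε s : ℤ) : Matrix.unitaryGroup (Fin N) ℂ) : Matrix (Fin N) (Fin N) ℂ) _ _ = _
    rw [coe_zpow_units, if_pos s.2]
    rfl
  · refine Finset.prod_congr rfl fun s _ => ?_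
    change ((U ^ (ε s : ℤ) : Matrix.unitaryGroup (Fin N) ℂ) : Matrix (Fin N) (Fin N) ℂ) _ _ = _
    rw [coe_zpow_units, if_neg (by rw [s.2]; decide)]
    rfl

theorem integral_permTrace_mul_zpow [DecidableEq I] (γ : Equiv.Perm I)
    (M : I → Matrix (Fin N) (Fin N) ℂ) :
    ∫ U, permTrace γ (fun k => M k *
        ((U ^ (ε k : ℤ) : Matrix.unitaryGroup (Fin N) ℂ) : Matrix (Fin N) (Fin N) ℂ))
        ∂haarUnitary N =
      ∑ x : I → Fin N, ∑ y : I → Fin N, (∏ k, M k (x k) (y k)) *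
        entryMoment (fun s : OutLabel ε => y s) (fun s : OutLabel ε => x (γ s))
          (fun s : InLabel ε => x (γ s)) (fun s : InLabel ε => y s) := by
  have hint (x y : I → Fin N) := (integrable_entryProd (fun s : OutLabel ε => y s)
    (fun s : OutLabel ε => x (γ s)) (fun s : InLabel ε => x (γ s))
    (fun s : InLabel ε => y s)).const_mul (∏ k, M k (x k) (y k))
  simp only [permTrace_eq_sum, sum_prod_mul_apply, prod_coe_zpow_apply ε _ _ fun _ => _]
  rw [integral_finsetSum _ fun x _ => integrable_finsetSum _ fun y _ => hint x y]
  refine Finset.sum_congr rfl fun x _ => ?_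
  rw [integral_finsetSum _ fun y _ => hint x y]
  exact Finset.sum_congr rfl fun y _ => integral_const_mul _ _

theorem card_outLabel_add_card_inLabel :
    Fintype.card (OutLabel ε) + Fintype.card (InLabel ε) = Fintype.card I :=
  Fintype.card_sum.symm.trans (Fintype.card_congr (labelEquiv ε))

end HaarMoments

end UnitaryMaps

end

open UnitaryMaps in
theorem corollary3p8_general {I : Type} [Fintype I] [LinearOrder I] {N : ℕ} (hN : 1 ≤ N)
    (hI : (Fintype.card I : ℝ) / 2 ≤ N) (ε : I → ℤˣ) (γ : Equiv.Perm I)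
    (M : I → Matrix (Fin N) (Fin N) ℂ) :
    (∀ r : ℕ, Finite (MapClass I r ε γ⁻¹)) ∧
    HasSum (fun r : ℕ =>
        (((-1 : ℝ) ^ r / (N : ℝ) ^ ((r : ℝ) + (Fintype.card I : ℝ) / 2) : ℝ) : ℂ) *
          ∑ᶠ C : MapClass I r ε γ⁻¹, permTrace C.phi M)
      (∫ U, permTrace γ (fun k => M k *
        ((U ^ (ε k : ℤ) : Matrix.unitaryGroup (Fin N) ℂ) : Matrix (Fin N) (Fin N) ℂ))
        ∂haarUnitary N) := by
  refine ⟨fun r => inferInstance, ?_⟩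
  rw [← card_outLabel_add_card_inLabel ε] at hI ⊢
  simp only [integral_permTrace_mul_zpow, finsum_permTrace_phi, Finset.mul_sum,
    mul_left_comm _ (∏ k, M k _ _)]
  exact hasSum_sum fun x _ => hasSum_sum fun y _ =>
    (hasSum_entryMoment (Nat.one_le_iff_ne_zero.1 hN) hI _ _ _ _).mul_left _

theorem corollary3p8 (N : ℕ) (hN : 1 ≤ N) (p : ℕ) (A : Fin p → Matrix (Fin N) (Fin N) ℂ)
    (l : ℕ) (hl : 1 ≤ l) (P : Fin l → UnitaryMaps.Monomial p)
    (m : ℝ) (hm : m = (UnitaryMaps.totalDeg P : ℝ) / 2) (hmN : m ≤ N) :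
    (∀ r : ℕ, Finite (UnitaryMaps.MapsOf P r)) ∧
    Summable (fun r : ℕ =>
      ‖(((-1 : ℝ) ^ r / (N : ℝ) ^ ((r : ℝ) + m) : ℝ) : ℂ) * UnitaryMaps.mapSum A P r‖) ∧
    HasSum (fun r : ℕ =>
        (((-1 : ℝ) ^ r / (N : ℝ) ^ ((r : ℝ) + m) : ℝ) : ℂ) * UnitaryMaps.mapSum A P r)
      (UnitaryMaps.haarMoment A fun i => (P i).toPoly) := by
  open UnitaryMaps in
  rw [← Fintype.card_fin (totalDeg P)] at hm
  obtain ⟨hfinite, hsum⟩ :=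
    corollary3p8_general hN (hm ▸ hmN) (signs P) (gammaPerm P) (coeffs A P)
  simp only [← hm, ← prod_trace_evalPoly] at hsum
  exact ⟨hfinite, hsum.summable.norm, hsum⟩
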